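/- Let $M$ and $N$ be smooth Hausdorff Banach manifolds (without boundary) modelled on Banach spaces $E$ and $E'$, and let $p\colon M\to N$ be a surjective submersion: around every $m\in M$ and around $p(m)$ there are charts in which $p$ becomes the projection $E\cong E'\times F\to E'$, for a fixed typical complement $F$ (the existence of a common $F$ is automatic if $M$ is connected). Then each fibre $M_x=p^{-1}(x)$, $x\in N$, is a submanifold of $M$ modelled on $F$, with inclusion $\iota_x\colon M_x\to M$; the fibre product $M\times_pM=\{(m,m')\in M\times M : p(m)=p(m')\}$ is a submanifold of $M\times M$; and the vertical bundle $\pi_{\mathcal V}\colon\mathcal V=\ker Tp\to M$ is a smooth Banach vector bundle with typical fibre $F$, anchored by the inclusion $\rho\colon\mathcal V\to TM$. The map $T\iota_x$ takes values in $\mathcal V$. A spray on a Banach vector bundle $\pi\colon A\to B$ over a Banach manifold $B$ with anchor $\rho\colon A\to TB$ is a smooth vector field $S\colon A\to TA$ such that $T\pi\circ S=\rho$ and $S\circ h_\lambda=Th_\lambda(\lambda S)$ for all $\lambda\in\mathbb R$, where $h_\lambda$ is fibrewise multiplication by $\lambda$; a spray on a manifold $B$ is a spray on $TB$ with anchor $\mathrm{id}_{TB}$.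 Its exponential map is $\exp_S=\pi\circ\mathrm{Fl}^S_1$, defined at those $v\in A$ for which the flow $\mathrm{Fl}^S_t(v)$ of $S$ exists up to time $1$. (a) Let $S$ be a spray on $(\pi_{\mathcal V},\mathcal V,\rho)$. For every $x\in N$ there is a unique spray $S_x\colon TM_x\to T^2M_x$ on the manifold $M_x$ that is $T\iota_x$-related to $S$, i.e. $T(T\iota_x)\circ S_x=S\circ T\iota_x$. (b) Suppose that $M$ is $C^\infty$-paracompact, i.e. paracompact and such that every open cover has a subordinate smooth partition of unity. Then there exists a spray on $(\pi_{\mathcal V},\mathcal V,\rho)$, and for every such spray $S$ there is an open neighbourhood $U\subseteq\mathcal V$ of the zero section on which $\exp_S$ is defined such that $\Psi=(\pi_{\mathcal V},\exp_S)|_U$ is a local addition on $p$: $\Psi$ is an open embedding (a diffeomorphism onto an open subset) of $U$ into $M\times_pM$ with $\Psi(0_m)=(m,m)$ for all $m\in M$ and $\mathrm{pr}_1\circ\Psi=\pi_{\mathcal V}|_U$. In particular, there exists a local addition on $p$. -/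

import Mathlib

open Set Function Manifold Bundle Topology
open scoped Manifold ContDiff Bundle

noncomputable section

namespace Spray

/-! ### Splitting submanifolds -/

section Submanifold

variable {B : Type*} [NormedAddCommGroup B] [NormedSpace ℝ B] {H : Type*} [TopologicalSpace H]
  (I : ModelWithCorners ℝ B H) {X : Type*} [TopologicalSpace X] [ChartedSpace H X]
  (G : Type*) [NormedAddCommGroup G] [NormedSpace ℝ G]

/-- A chart, with values in `G`, of a subset `A` of a manifold `X`: a smooth map `toFun` on an open
subset `dom` of `X` which restricts to a bijection from `A ∩ dom` onto an open subset `cod` of `G`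
whose inverse `invFun` is smooth as a map into `X`. -/
structure SubmanifoldChart (A : Set X) where
  dom : Set X
  cod : Set G
  toFun : X → G
  invFun : G → X
  isOpen_dom : IsOpen dom
  isOpen_cod : IsOpen cod
  mapsTo : ∀ y ∈ A, y ∈ dom → toFun y ∈ cod
  invFun_mem : ∀ g ∈ cod, invFun g ∈ A
  invFun_mem_dom : ∀ g ∈ cod, invFun g ∈ dom
  left_inv : ∀ y ∈ A, y ∈ dom → invFun (toFun y) = y
  right_inv : ∀ g ∈ cod, toFun (invFun g) = g
  contMDiffOn_toFun : ContMDiffOn I 𝓘(ℝ, G) ∞ toFun dom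
  contMDiffOn_invFun : ContMDiffOn 𝓘(ℝ, G) I ∞ invFun cod

variable {I G}

open Classical in
/-- The chart of the topological space `A` given by a `SubmanifoldChart`; the point `a` only
provides the irrelevant values of the inverse outside of the target. -/
def SubmanifoldChart.chart {A : Set X} (c : SubmanifoldChart I G A) (a : A) :
    OpenPartialHomeomorph A G where
  toFun y := c.toFun y
  invFun g := if h : g ∈ c.cod then ⟨c.invFun g, c.invFun_mem g h⟩ else a
  source := {y : A | (y : X) ∈ c.dom}
  target := c.cod
  map_source' y hy := c.mapsTo y y.2 hy
  map_target' g hg := by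
    simp only [dif_pos hg]
    exact c.invFun_mem_dom g hg
  left_inv' y hy := by
    simp only [dif_pos (c.mapsTo y y.2 hy)]
    exact Subtype.ext (c.left_inv y y.2 hy)
  right_inv' g hg := by
    simp only [dif_pos hg]
    exact c.right_inv g hg
  open_source := c.isOpen_dom.preimage continuous_subtype_val
  open_target := c.isOpen_cod
  continuousOn_toFun := c.contMDiffOn_toFun.continuousOn.comp
    continuous_subtype_val.continuousOn fun _ h ↦ h
  continuousOn_invFun := by
    rw [IsInducing.subtypeVal.continuousOn_iff]
    refine c.contMDiffOn_invFun.continuousOn.congr fun g hg ↦ ?_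
    simp [dif_pos hg]

open Classical in
theorem SubmanifoldChart.val_chart_symm {A : Set X} (c : SubmanifoldChart I G A) (a : A) {g : G}
    (hg : g ∈ c.cod) : (((c.chart a).symm g : A) : X) = c.invFun g := by
  change ((if h : g ∈ c.cod then (⟨c.invFun g, c.invFun_mem g h⟩ : A) else a : A) : X) = _
  rw [dif_pos hg]

/-- The atlas on `A` given by a submanifold chart around every point. -/
abbrev submanifoldChartedSpace {A : Set X} (c : A → SubmanifoldChart I G A)
    (hc : ∀ a : A, (a : X) ∈ (c a).dom) : ChartedSpace G A where
  atlas := range fun a ↦ (c a).chart a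
  chartAt a := (c a).chart a
  mem_chart_source a := hc a
  chart_mem_atlas a := mem_range_self a

theorem submanifold_isManifold {A : Set X} (c : A → SubmanifoldChart I G A)
    (hc : ∀ a : A, (a : X) ∈ (c a).dom) :
    letI := submanifoldChartedSpace c hc
    IsManifold 𝓘(ℝ, G) ∞ A := by
  let := submanifoldChartedSpace c hc
  apply isManifold_of_contDiffOn
  rintro _ _ ⟨a, rfl⟩ ⟨b, rfl⟩
  rw [← contMDiffOn_iff_contDiffOn]
  have h : ContMDiffOn 𝓘(ℝ, G) 𝓘(ℝ, G) ∞ ((c b).toFun ∘ (c a).invFun)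
      ((c a).cod ∩ (c a).invFun ⁻¹' (c b).dom) :=
    (c b).contMDiffOn_toFun.comp ((c a).contMDiffOn_invFun.mono inter_subset_left)
      fun _ h ↦ h.2
  have key : ∀ g ∈ 𝓘(ℝ, G).symm ⁻¹' (((c a).chart a).symm ≫ₕ (c b).chart b).source ∩
      range 𝓘(ℝ, G), g ∈ (c a).cod ∧ (((c a).chart a).symm g : X) ∈ (c b).dom := by
    rintro g ⟨hg, -⟩
    simpa using! hg
  refine (h.mono fun g hg ↦ ?_).congr fun g hg ↦ ?_
  · obtain ⟨h1, h2⟩ := key g hg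
    rw [SubmanifoldChart.val_chart_symm _ _ h1] at h2
    exact ⟨h1, h2⟩
  · obtain ⟨h1, h2⟩ := key g hg
    change (c b).toFun (((c a).chart a).symm g : X) = _
    rw [SubmanifoldChart.val_chart_symm _ _ h1]
    rfl

theorem submanifold_contMDiff_val {A : Set X} (c : A → SubmanifoldChart I G A)
    (hc : ∀ a : A, (a : X) ∈ (c a).dom) :
    letI := submanifoldChartedSpace c hc
    ContMDiff 𝓘(ℝ, G) I ∞ (Subtype.val : A → X) := by
  let := submanifoldChartedSpace c hc
  have := submanifold_isManifold c hc
  intro a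
  have h1 : ContMDiffAt 𝓘(ℝ, G) 𝓘(ℝ, G) ∞ (chartAt G a) a :=
    contMDiffAt_of_mem_maximalAtlas (IsManifold.chart_mem_maximalAtlas a) (mem_chart_source G a)
  have h2 : ContMDiffAt 𝓘(ℝ, G) I ∞ (c a).invFun (chartAt G a a) :=
    (c a).contMDiffOn_invFun.contMDiffAt
      ((c a).isOpen_cod.mem_nhds ((c a).mapsTo a a.2 (hc a)))
  refine (h2.comp a h1).congr_of_eventuallyEq ?_
  filter_upwards [(chartAt G a).open_source.mem_nhds (mem_chart_source G a)] with y hy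
  exact ((c a).left_inv y y.2 hy).symm

end Submanifold

/-! ### Fibres, fibre product and vertical bundle of a submersion -/

section Submersion

variable {E E' F : Type*} [NormedAddCommGroup E] [NormedSpace ℝ E]
  [NormedAddCommGroup E'] [NormedSpace ℝ E'] [NormedAddCommGroup F] [NormedSpace ℝ F]
  {M N : Type*} [TopologicalSpace M] [ChartedSpace E M] [TopologicalSpace N] [ChartedSpace E' N]
  {p : M → N}

theorem submersion_chart_eq {m : M}
    (h : IsSubmersionAtOfComplement F 𝓘(ℝ, E) 𝓘(ℝ, E') ∞ p m) {y : M} (hy : y ∈ h.domChart.source) :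
    (h.equiv (h.domChart y)).1 = h.codChart (p y) := by
  have ht : h.domChart y ∈ (h.domChart.extend 𝓘(ℝ, E)).target := by
    simpa using h.domChart.map_source hy
  have := h.writtenInCharts ht
  simpa [h.domChart.left_inv hy] using this.symm

/-- In submersion charts around `m`, the fibre through `m` has the coordinate in `F` as chart. -/
def fibreChart (hp : IsSubmersionOfComplement F 𝓘(ℝ, E) 𝓘(ℝ, E') ∞ p) (x : N)
    (m : p ⁻¹' {x}) : SubmanifoldChart 𝓘(ℝ, E) F (p ⁻¹' {x}) where
  dom := (hp m).domChart.source
  cod := (fun b : F ↦ (hp m).equiv.symm ((hp m).codChart x, b)) ⁻¹' (hp m).domChart.target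
  toFun y := ((hp m).equiv ((hp m).domChart y)).2
  invFun b := (hp m).domChart.symm ((hp m).equiv.symm ((hp m).codChart x, b))
  isOpen_dom := (hp m).domChart.open_source
  isOpen_cod := (hp m).domChart.open_target.preimage (by fun_prop)
  mapsTo y hy hd := by
    have h : (hp m).codChart x = ((hp m).equiv ((hp m).domChart y)).1 := by
      rw [submersion_chart_eq (hp m) hd, hy]
    simpa [h] using (hp m).domChart.map_source hd
  invFun_mem b hb := by
    have hs := (hp m).domChart.map_target hb
    have h := submersion_chart_eq (hp m) hs
    rw [(hp m).domChart.right_inv hb] at h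
    refine ((hp m).codChart.injOn ?_ ((hp m).source_subset_preimage_source hs) ?_).symm
    · have := (hp m).mem_codChart_source
      rwa [show p m = x from m.2] at this
    · simpa using h
  invFun_mem_dom b hb := (hp m).domChart.map_target hb
  left_inv y hy hd := by
    have h : (hp m).codChart x = ((hp m).equiv ((hp m).domChart y)).1 := by
      rw [submersion_chart_eq (hp m) hd, hy]
    simp [h, (hp m).domChart.left_inv hd]
  right_inv b hb := by simp [(hp m).domChart.right_inv hb]
  contMDiffOn_toFun := by
    have h1 : ContDiff ℝ ∞ fun e : E ↦ ((hp m).equiv e).2 := by fun_prop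
    exact h1.contMDiff.comp_contMDiffOn
      (contMDiffOn_of_mem_maximalAtlas (hp m).domChart_mem_maximalAtlas)
  contMDiffOn_invFun := by
    have h1 : ContDiff ℝ ∞ fun b : F ↦ (hp m).equiv.symm ((hp m).codChart x, b) := by fun_prop
    exact (contMDiffOn_symm_of_mem_maximalAtlas (hp m).domChart_mem_maximalAtlas).comp
      h1.contMDiff.contMDiffOn fun _ h ↦ h

/-- The fibre `p ⁻¹ (x)` of a submersion `p`, a manifold modelled on `F`. -/
def Fibre (_hp : IsSubmersionOfComplement F 𝓘(ℝ, E) 𝓘(ℝ, E') ∞ p) (x : N) : Type _ :=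
  ↥(p ⁻¹' {x})

instance (hp : IsSubmersionOfComplement F 𝓘(ℝ, E) 𝓘(ℝ, E') ∞ p) (x : N) :
    TopologicalSpace (Fibre hp x) :=
  inferInstanceAs (TopologicalSpace ↥(p ⁻¹' {x}))

instance (hp : IsSubmersionOfComplement F 𝓘(ℝ, E) 𝓘(ℝ, E') ∞ p) (x : N) :
    ChartedSpace F (Fibre hp x) :=
  submanifoldChartedSpace (fibreChart hp x) fun m ↦ (hp m).mem_domChart_source

instance (hp : IsSubmersionOfComplement F 𝓘(ℝ, E) 𝓘(ℝ, E') ∞ p) (x : N) :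
    IsManifold 𝓘(ℝ, F) ∞ (Fibre hp x) :=
  submanifold_isManifold (fibreChart hp x) fun m ↦ (hp m).mem_domChart_source

/-- The inclusion of a fibre. -/
def fibreIncl (hp : IsSubmersionOfComplement F 𝓘(ℝ, E) 𝓘(ℝ, E') ∞ p) (x : N) :
    Fibre hp x → M :=
  Subtype.val

theorem contMDiff_fibreIncl (hp : IsSubmersionOfComplement F 𝓘(ℝ, E) 𝓘(ℝ, E') ∞ p) (x : N) :
    ContMDiff 𝓘(ℝ, F) 𝓘(ℝ, E) ∞ (fibreIncl hp x) :=
  submanifold_contMDiff_val (fibreChart hp x) fun m ↦ (hp m).mem_domChart_source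

/-- Around `(m₁, m₂)`, the fibre product has as chart the coordinate in `E` of the first point and
the coordinate in `F` of the second point, with respect to submersion charts around `m₁`, `m₂`. -/
def fibreProductChart (hp : IsSubmersionOfComplement F 𝓘(ℝ, E) 𝓘(ℝ, E') ∞ p)
    (q : {q : M × M | p q.1 = p q.2}) :
    SubmanifoldChart (𝓘(ℝ, E).prod 𝓘(ℝ, E)) (E × F) {q : M × M | p q.1 = p q.2} where
  dom := (hp q.1.1).domChart.source ×ˢ (hp q.1.2).domChart.source
  cod := {g : E × F | (g.1 ∈ (hp q.1.1).domChart.target ∧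
      p ((hp q.1.1).domChart.symm g.1) ∈ (hp q.1.2).codChart.source) ∧
    (hp q.1.2).equiv.symm ((hp q.1.2).codChart (p ((hp q.1.1).domChart.symm g.1)), g.2) ∈
      (hp q.1.2).domChart.target}
  toFun y := ((hp q.1.1).domChart y.1, ((hp q.1.2).equiv ((hp q.1.2).domChart y.2)).2)
  invFun g := ((hp q.1.1).domChart.symm g.1, (hp q.1.2).domChart.symm
    ((hp q.1.2).equiv.symm ((hp q.1.2).codChart (p ((hp q.1.1).domChart.symm g.1)), g.2)))
  isOpen_dom := (hp q.1.1).domChart.open_source.prod (hp q.1.2).domChart.open_source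
  isOpen_cod := by
    have h1 : IsOpen {e : E | e ∈ (hp q.1.1).domChart.target ∧
        p ((hp q.1.1).domChart.symm e) ∈ (hp q.1.2).codChart.source} :=
      (hp.contMDiff.continuous.comp_continuousOn
        (hp q.1.1).domChart.continuousOn_symm).isOpen_inter_preimage
          (hp q.1.1).domChart.open_target (hp q.1.2).codChart.open_source
    have h2 : ContinuousOn (fun g : E × F ↦ (hp q.1.2).equiv.symm
        ((hp q.1.2).codChart (p ((hp q.1.1).domChart.symm g.1)), g.2))
        {g : E × F | g.1 ∈ (hp q.1.1).domChart.target ∧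
          p ((hp q.1.1).domChart.symm g.1) ∈ (hp q.1.2).codChart.source} := by
      refine (hp q.1.2).equiv.symm.continuous.comp_continuousOn
        (ContinuousOn.prodMk ?_ continuousOn_snd)
      refine (hp q.1.2).codChart.continuousOn.comp (hp.contMDiff.continuous.comp_continuousOn
        ((hp q.1.1).domChart.continuousOn_symm.comp continuousOn_fst fun _ h ↦ h.1)) ?_
      exact fun _ h ↦ h.2
    exact h2.isOpen_inter_preimage (h1.preimage continuous_fst) (hp q.1.2).domChart.open_target
  mapsTo y hy hd := by
    have hy' : p y.1 = p y.2 := hy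
    refine ⟨⟨(hp q.1.1).domChart.map_source hd.1, ?_⟩, ?_⟩
    · simp only [(hp q.1.1).domChart.left_inv hd.1, hy']
      exact (hp q.1.2).source_subset_preimage_source hd.2
    · simp only [(hp q.1.1).domChart.left_inv hd.1, hy',
        ← submersion_chart_eq (hp q.1.2) hd.2, Prod.mk.eta,
        ContinuousLinearEquiv.symm_apply_apply]
      exact (hp q.1.2).domChart.map_source hd.2
  invFun_mem g hg := by
    have hs := (hp q.1.2).domChart.map_target hg.2
    have h := submersion_chart_eq (hp q.1.2) hs
    rw [(hp q.1.2).domChart.right_inv hg.2] at h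
    refine (hp q.1.2).codChart.injOn hg.1.2 ((hp q.1.2).source_subset_preimage_source hs) ?_
    simpa using h
  invFun_mem_dom g hg :=
    ⟨(hp q.1.1).domChart.map_target hg.1.1, (hp q.1.2).domChart.map_target hg.2⟩
  left_inv y hy hd := by
    have hy' : p y.1 = p y.2 := hy
    simp [(hp q.1.1).domChart.left_inv hd.1, hy', ← submersion_chart_eq (hp q.1.2) hd.2,
      (hp q.1.2).domChart.left_inv hd.2]
  right_inv g hg := by
    simp [(hp q.1.1).domChart.right_inv hg.1.1, (hp q.1.2).domChart.right_inv hg.2]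
  contMDiffOn_toFun := by
    have h1 : ContDiff ℝ ∞ fun e : E ↦ ((hp q.1.2).equiv e).2 := by fun_prop
    exact ((contMDiffOn_of_mem_maximalAtlas (hp q.1.1).domChart_mem_maximalAtlas).comp
      contMDiffOn_fst fun _ h ↦ h.1).prodMk_space
      (h1.contMDiff.comp_contMDiffOn
        ((contMDiffOn_of_mem_maximalAtlas (hp q.1.2).domChart_mem_maximalAtlas).comp
          contMDiffOn_snd fun _ h ↦ h.2))
  contMDiffOn_invFun := by
    have h0 : ContMDiff 𝓘(ℝ, E × F) 𝓘(ℝ, E) ∞ (Prod.fst : E × F → E) := contDiff_fst.contMDiff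
    have h0' : ContMDiff 𝓘(ℝ, E × F) 𝓘(ℝ, F) ∞ (Prod.snd : E × F → F) := contDiff_snd.contMDiff
    have h1 := (contMDiffOn_symm_of_mem_maximalAtlas
      (hp q.1.1).domChart_mem_maximalAtlas).comp (h0.contMDiffOn (s := {g : E × F |
        (g.1 ∈ (hp q.1.1).domChart.target ∧
          p ((hp q.1.1).domChart.symm g.1) ∈ (hp q.1.2).codChart.source) ∧
        (hp q.1.2).equiv.symm ((hp q.1.2).codChart (p ((hp q.1.1).domChart.symm g.1)), g.2) ∈
          (hp q.1.2).domChart.target})) fun _ h ↦ h.1.1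
    refine h1.prodMk ?_
    have h2 := (contMDiffOn_of_mem_maximalAtlas (hp q.1.2).codChart_mem_maximalAtlas).comp
      (hp.contMDiff.comp_contMDiffOn h1) fun _ h ↦ h.1.2
    have h3 := (hp q.1.2).equiv.symm.contDiff (n := ∞) |>.contMDiff.comp_contMDiffOn
      (h2.prodMk_space h0'.contMDiffOn)
    exact (contMDiffOn_symm_of_mem_maximalAtlas (hp q.1.2).domChart_mem_maximalAtlas).comp
      h3 fun _ h ↦ h.2

/-- The fibre product `M ×_p M` of a submersion `p`, a manifold modelled on `E × F`. -/
def FibreProduct (_hp : IsSubmersionOfComplement F 𝓘(ℝ, E) 𝓘(ℝ, E') ∞ p) : Type _ :=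
  ↥{q : M × M | p q.1 = p q.2}

instance (hp : IsSubmersionOfComplement F 𝓘(ℝ, E) 𝓘(ℝ, E') ∞ p) :
    TopologicalSpace (FibreProduct hp) :=
  inferInstanceAs (TopologicalSpace ↥{q : M × M | p q.1 = p q.2})

instance (hp : IsSubmersionOfComplement F 𝓘(ℝ, E) 𝓘(ℝ, E') ∞ p) :
    ChartedSpace (E × F) (FibreProduct hp) :=
  submanifoldChartedSpace (fibreProductChart hp) fun q ↦
    ⟨(hp q.1.1).mem_domChart_source, (hp q.1.2).mem_domChart_source⟩

instance (hp : IsSubmersionOfComplement F 𝓘(ℝ, E) 𝓘(ℝ, E') ∞ p) :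
    IsManifold 𝓘(ℝ, E × F) ∞ (FibreProduct hp) :=
  submanifold_isManifold (fibreProductChart hp) fun q ↦
    ⟨(hp q.1.1).mem_domChart_source, (hp q.1.2).mem_domChart_source⟩

/-- The first projection of the fibre product. -/
def FibreProduct.fst {hp : IsSubmersionOfComplement F 𝓘(ℝ, E) 𝓘(ℝ, E') ∞ p}
    (q : FibreProduct hp) : M :=
  q.1.1

/-- The second projection of the fibre product. -/
def FibreProduct.snd {hp : IsSubmersionOfComplement F 𝓘(ℝ, E) 𝓘(ℝ, E') ∞ p}
    (q : FibreProduct hp) : M :=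
  q.1.2

/-- The vertical space at `m`: the kernel of `T_m p`. -/
def Vertical (_hp : IsSubmersionOfComplement F 𝓘(ℝ, E) 𝓘(ℝ, E') ∞ p) (m : M) : Type _ :=
  ↥(mfderiv 𝓘(ℝ, E) 𝓘(ℝ, E') p m).ker

section

variable (hp : IsSubmersionOfComplement F 𝓘(ℝ, E) 𝓘(ℝ, E') ∞ p)

instance (m : M) : AddCommGroup (Vertical hp m) :=
  inferInstanceAs (AddCommGroup ↥(mfderiv 𝓘(ℝ, E) 𝓘(ℝ, E') p m).ker)

instance (m : M) : Module ℝ (Vertical hp m) :=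
  inferInstanceAs (Module ℝ ↥(mfderiv 𝓘(ℝ, E) 𝓘(ℝ, E') p m).ker)

instance (m : M) : TopologicalSpace (Vertical hp m) :=
  inferInstanceAs (TopologicalSpace ↥(mfderiv 𝓘(ℝ, E) 𝓘(ℝ, E') p m).ker)

/-- The inclusion of the vertical space into the tangent space. -/
def verticalIncl (m : M) : Vertical hp m →L[ℝ] TangentSpace 𝓘(ℝ, E) m :=
  (mfderiv 𝓘(ℝ, E) 𝓘(ℝ, E') p m).ker.subtypeL

theorem mdifferentiableAt_domChart (m : M) {y : M} (hy : y ∈ (hp m).domChart.source) :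
    MDifferentiableAt 𝓘(ℝ, E) 𝓘(ℝ, E) (hp m).domChart y :=
  (contMDiffAt_of_mem_maximalAtlas (hp m).domChart_mem_maximalAtlas hy).mdifferentiableAt
    (by simp)

theorem mdifferentiableAt_domChart_symm (m : M) {g : E} (hg : g ∈ (hp m).domChart.target) :
    MDifferentiableAt 𝓘(ℝ, E) 𝓘(ℝ, E) (hp m).domChart.symm g :=
  (contMDiffAt_symm_of_mem_maximalAtlas (hp m).domChart_mem_maximalAtlas hg).mdifferentiableAt
    (by simp)

theorem mdifferentiable_domChart (m : M) :
    (hp m).domChart.MDifferentiable 𝓘(ℝ, E) 𝓘(ℝ, E) :=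
  ⟨fun _ hy ↦ (mdifferentiableAt_domChart hp m hy).mdifferentiableWithinAt,
    fun _ hy ↦ (mdifferentiableAt_domChart_symm hp m hy).mdifferentiableWithinAt⟩

/-- In submersion charts, the vertical vectors are those whose component in `E'` vanishes. -/
theorem mem_vertical_iff (m : M) {y : M} (hy : y ∈ (hp m).domChart.source)
    (v : TangentSpace 𝓘(ℝ, E) y) :
    mfderiv 𝓘(ℝ, E) 𝓘(ℝ, E') p y v = 0 ↔
      ((hp m).equiv (mfderiv 𝓘(ℝ, E) 𝓘(ℝ, E) (hp m).domChart y v : E)).1 = 0 := by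
  have hpy := (hp m).source_subset_preimage_source hy
  have hc : (hp m).codChart.MDifferentiable 𝓘(ℝ, E') 𝓘(ℝ, E') :=
    ⟨fun _ h ↦ ((contMDiffAt_of_mem_maximalAtlas (hp m).codChart_mem_maximalAtlas
      h).mdifferentiableAt (by simp)).mdifferentiableWithinAt,
    fun _ h ↦ ((contMDiffAt_symm_of_mem_maximalAtlas (hp m).codChart_mem_maximalAtlas
      h).mdifferentiableAt (by simp)).mdifferentiableWithinAt⟩
  have hpd : MDifferentiableAt 𝓘(ℝ, E) 𝓘(ℝ, E') p y :=
    (hp.contMDiff y).mdifferentiableAt (by simp)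
  have hφ := mdifferentiableAt_domChart hp m hy
  have h1 : HasMFDerivAt 𝓘(ℝ, E) 𝓘(ℝ, E') ((hp m).codChart ∘ p) y
      ((mfderiv 𝓘(ℝ, E') 𝓘(ℝ, E') (hp m).codChart (p y)).comp
        (mfderiv 𝓘(ℝ, E) 𝓘(ℝ, E') p y)) :=
    (hc.mdifferentiableAt hpy).hasMFDerivAt.comp y hpd.hasMFDerivAt
  let L : E →L[ℝ] E' := (ContinuousLinearMap.fst ℝ E' F).comp
    ((hp m).equiv : E →L[ℝ] E' × F)
  have h2 : HasMFDerivAt 𝓘(ℝ, E) 𝓘(ℝ, E') (L ∘ (hp m).domChart) y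
      (L.comp (mfderiv 𝓘(ℝ, E) 𝓘(ℝ, E) (hp m).domChart y)) :=
    L.hasMFDerivAt.comp y hφ.hasMFDerivAt
  have h3 : (hp m).codChart ∘ p =ᶠ[𝓝 y] L ∘ (hp m).domChart := by
    filter_upwards [(hp m).domChart.open_source.mem_nhds hy] with z hz
    exact (submersion_chart_eq (hp m) hz).symm
  have h4 := hasMFDerivAt_unique h1 (h2.congr_of_eventuallyEq h3)
  have h5 : mfderiv 𝓘(ℝ, E') 𝓘(ℝ, E') (hp m).codChart (p y) (mfderiv 𝓘(ℝ, E) 𝓘(ℝ, E') p y v) =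
      ((hp m).equiv (mfderiv 𝓘(ℝ, E) 𝓘(ℝ, E) (hp m).domChart y v : E)).1 :=
    DFunLike.congr_fun h4 v
  rw [← h5]
  exact (map_eq_zero_iff _ (hc.mfderiv_injective hpy)).symm

/-- The tangent map at `y` of the submersion chart around `m`. -/
def chartDeriv (m : M) {y : M} (hy : y ∈ (hp m).domChart.source) :
    TangentSpace 𝓘(ℝ, E) y ≃L[ℝ] E' × F :=
  ContinuousLinearEquiv.trans (M₂ := E) ((mdifferentiable_domChart hp m).mfderiv hy) (hp m).equiv

theorem chartDeriv_apply (m : M) {y : M} (hy : y ∈ (hp m).domChart.source)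
    (v : TangentSpace 𝓘(ℝ, E) y) :
    chartDeriv hp m hy v =
      (hp m).equiv (mfderiv 𝓘(ℝ, E) 𝓘(ℝ, E) (hp m).domChart y v : E) := rfl

theorem chartDeriv_symm_mem (m : M) {y : M} (hy : y ∈ (hp m).domChart.source) (w : F) :
    (chartDeriv hp m hy).symm (0, w) ∈ (mfderiv 𝓘(ℝ, E) 𝓘(ℝ, E') p y).ker := by
  refine (mem_vertical_iff hp m hy _).2 ?_
  rw [← chartDeriv_apply hp m hy, ContinuousLinearEquiv.apply_symm_apply]

/-- Over the domain of a submersion chart `φ` around `m`, the vertical space at `y` is identified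
with `F` by taking a vertical vector `v` to the component of `Tφ (v)` in `F`. -/
def verticalEquiv (m : M) {y : M} (hy : y ∈ (hp m).domChart.source) :
    Vertical hp y ≃L[ℝ] F where
  toFun v := (chartDeriv hp m hy (verticalIncl hp y v)).2
  invFun w := ⟨(chartDeriv hp m hy).symm (0, w), chartDeriv_symm_mem hp m hy w⟩
  map_add' v w := by simp
  map_smul' a v := by simp
  left_inv v := by
    have h : (chartDeriv hp m hy (verticalIncl hp y v)).1 = 0 :=
      (mem_vertical_iff hp m hy _).1 v.2
    refine Subtype.ext ?_
    change (chartDeriv hp m hy).symm (0, (chartDeriv hp m hy (verticalIncl hp y v)).2) = _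
    rw [← h, Prod.mk.eta, ContinuousLinearEquiv.symm_apply_apply]
    rfl
  right_inv w := by
    change (chartDeriv hp m hy ((chartDeriv hp m hy).symm (0, w))).2 = w
    rw [ContinuousLinearEquiv.apply_symm_apply]
  continuous_toFun := by
    fun_prop
  continuous_invFun := by
    refine Continuous.subtype_mk ?_ _
    fun_prop

/-- The bundle coordinates of a vertical vector with respect to the submersion chart around `m`. -/
def verticalCoord (m : M) (v : TotalSpace F (Vertical hp)) : M × F :=
  (v.1, ((hp m).equiv
    (mfderiv 𝓘(ℝ, E) 𝓘(ℝ, E) (hp m).domChart v.1 (verticalIncl hp v.1 v.2) : E)).2)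

open Classical in
/-- The trivialisation of the vertical bundle over the domain of a submersion chart. -/
def verticalPretrivialization (m : M) : Pretrivialization F (π F (Vertical hp)) where
  toFun := verticalCoord hp m
  invFun w := if h : w.1 ∈ (hp m).domChart.source then ⟨w.1, (verticalEquiv hp m h).symm w.2⟩
    else ⟨w.1, 0⟩
  source := π F (Vertical hp) ⁻¹' (hp m).domChart.source
  target := (hp m).domChart.source ×ˢ univ
  map_source' v hv := ⟨hv, mem_univ _⟩
  map_target' w hw := by
    rw [dif_pos hw.1]
    exact hw.1
  left_inv' v hv := by
    have hv' : v.1 ∈ (hp m).domChart.source := hv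
    refine (dif_pos hv').trans ?_
    obtain ⟨b, v⟩ := v
    congr 1
    exact (verticalEquiv hp m hv').symm_apply_apply v
  right_inv' w hw := by
    have hw' : w.1 ∈ (hp m).domChart.source := hw.1
    rw [dif_pos hw']
    exact Prod.ext rfl ((verticalEquiv hp m hw').apply_symm_apply w.2)
  open_target := (hp m).domChart.open_source.prod isOpen_univ
  baseSet := (hp m).domChart.source
  open_baseSet := (hp m).domChart.open_source
  source_eq := rfl
  target_eq := rfl
  proj_toFun _ _ := rfl

theorem verticalPretrivialization_apply (m : M) {y : M} (hy : y ∈ (hp m).domChart.source)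
    (v : Vertical hp y) :
    (verticalPretrivialization hp m ⟨y, v⟩).2 = verticalEquiv hp m hy v := rfl

theorem verticalPretrivialization_symm (m : M) {y : M} (hy : y ∈ (hp m).domChart.source)
    (w : F) :
    (verticalPretrivialization hp m).symm y w = (verticalEquiv hp m hy).symm w := by
  apply (verticalEquiv hp m hy).injective
  rw [ContinuousLinearEquiv.apply_symm_apply, ← verticalPretrivialization_apply,
    Pretrivialization.apply_mk_symm _ hy]

instance verticalPretrivialization_isLinear (m : M) :
    (verticalPretrivialization hp m).IsLinear ℝ where
  linear _ hy := (verticalEquiv hp m hy).toLinearEquiv.toLinearMap.isLinear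

/-- The coordinate change of the vertical bundle between two submersion charts. -/
def verticalCoordChange (m m' : M) (y : M) : F →L[ℝ] F :=
  (ContinuousLinearMap.snd ℝ E' F).comp (((hp m').equiv : E →L[ℝ] E' × F).comp
    ((fderiv ℝ ((hp m').domChart ∘ (hp m).domChart.symm) ((hp m).domChart y)).comp
      (((hp m).equiv.symm : E' × F →L[ℝ] E).comp (ContinuousLinearMap.inr ℝ E' F))))

theorem contMDiffOn_verticalCoordChange (m m' : M) :
    ContMDiffOn 𝓘(ℝ, E) 𝓘(ℝ, F →L[ℝ] F) ∞ (verticalCoordChange hp m m')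
      ((hp m).domChart.source ∩ (hp m').domChart.source) := by
  have h1 : ContDiffOn ℝ ∞ ((hp m').domChart ∘ (hp m).domChart.symm)
      ((hp m).domChart.target ∩ (hp m).domChart.symm ⁻¹' (hp m').domChart.source) := by
    rw [← contMDiffOn_iff_contDiffOn]
    exact (contMDiffOn_of_mem_maximalAtlas (hp m').domChart_mem_maximalAtlas).comp
      ((contMDiffOn_symm_of_mem_maximalAtlas (hp m).domChart_mem_maximalAtlas).mono
        inter_subset_left) fun _ h ↦ h.2
  have h2 := h1.fderiv_of_isOpen (m := ∞)
    ((hp m).domChart.isOpen_inter_preimage_symm (hp m').domChart.open_source) (by simp)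
  have h3 := h2.contMDiffOn.comp
    ((contMDiffOn_of_mem_maximalAtlas (hp m).domChart_mem_maximalAtlas).mono
      (inter_subset_left (t := (hp m').domChart.source))) fun y hy ↦
      ⟨(hp m).domChart.map_source hy.1, by
        simpa [(hp m).domChart.left_inv hy.1] using hy.2⟩
  have h4 : ContDiff ℝ ∞ fun D : E →L[ℝ] E ↦ (ContinuousLinearMap.snd ℝ E' F).comp
      (((hp m').equiv : E →L[ℝ] E' × F).comp (D.comp
        (((hp m).equiv.symm : E' × F →L[ℝ] E).comp (ContinuousLinearMap.inr ℝ E' F)))) := by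
    fun_prop
  exact h4.contMDiff.comp_contMDiffOn h3

theorem verticalCoordChange_apply (m m' : M) {y : M} (hy : y ∈ (hp m).domChart.source)
    (hy' : y ∈ (hp m').domChart.source) (w : F) :
    verticalCoordChange hp m m' y w =
      (verticalPretrivialization hp m' ⟨y, (verticalPretrivialization hp m).symm y w⟩).2 := by
  rw [verticalPretrivialization_symm hp m hy, verticalPretrivialization_apply hp m' hy']
  let u : TangentSpace 𝓘(ℝ, E) y := (chartDeriv hp m hy).symm (0, w)
  have hu : (mfderiv 𝓘(ℝ, E) 𝓘(ℝ, E) (hp m).domChart y u : E) = (hp m).equiv.symm (0, w) := by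
    have h0 : (hp m).equiv (mfderiv 𝓘(ℝ, E) 𝓘(ℝ, E) (hp m).domChart y u : E) = (0, w) :=
      (chartDeriv hp m hy).apply_symm_apply (0, w)
    exact ((hp m).equiv.eq_symm_apply).2 h0
  have hs : (hp m).domChart.symm ((hp m).domChart y) = y := (hp m).domChart.left_inv hy
  have h1 : MDifferentiableAt 𝓘(ℝ, E) 𝓘(ℝ, E) ((hp m').domChart ∘ (hp m).domChart.symm)
      ((hp m).domChart y) :=
    MDifferentiableAt.comp _ (mdifferentiableAt_domChart hp m' (by rwa [hs]))
      (mdifferentiableAt_domChart_symm hp m ((hp m).domChart.map_source hy))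
  have h2 := h1.hasMFDerivAt.comp y (mdifferentiableAt_domChart hp m hy).hasMFDerivAt
  have h3 : (hp m').domChart =ᶠ[𝓝 y]
      ((hp m').domChart ∘ (hp m).domChart.symm) ∘ (hp m).domChart := by
    filter_upwards [(hp m).domChart.open_source.mem_nhds hy] with z hz
    simp [(hp m).domChart.left_inv hz]
  have h4 := DFunLike.congr_fun (h2.congr_of_eventuallyEq h3).mfderiv u
  have h5 : (mfderiv 𝓘(ℝ, E) 𝓘(ℝ, E) (hp m').domChart y u : E) =
      fderiv ℝ ((hp m').domChart ∘ (hp m).domChart.symm) ((hp m).domChart y)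
        ((hp m).equiv.symm (0, w)) := by
    rw [← hu, ← mfderiv_eq_fderiv]
    exact h4
  change _ = ((hp m').equiv (mfderiv 𝓘(ℝ, E) 𝓘(ℝ, E) (hp m').domChart y u : E)).2
  rw [h5]
  rfl

/-- The vertical bundle as a vector bundle with typical fibre `F`. -/
def verticalPrebundle : VectorPrebundle ℝ F (Vertical hp) where
  pretrivializationAtlas := range (verticalPretrivialization hp)
  pretrivialization_linear' := by
    rintro _ ⟨m, rfl⟩
    infer_instance
  pretrivializationAt := verticalPretrivialization hp
  mem_base_pretrivializationAt m := (hp m).mem_domChart_source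
  pretrivialization_mem_atlas := mem_range_self
  exists_coordChange := by
    rintro _ ⟨m, rfl⟩ _ ⟨m', rfl⟩
    exact ⟨verticalCoordChange hp m m', (contMDiffOn_verticalCoordChange hp m m').continuousOn,
      fun y hy w ↦ verticalCoordChange_apply hp m m' hy.1 hy.2 w⟩
  totalSpaceMk_isInducing m :=
    (isInducing_const_prod.2 IsInducing.id).comp
      (verticalEquiv hp m (hp m).mem_domChart_source).toHomeomorph.isInducing

instance : (verticalPrebundle hp).IsContMDiff 𝓘(ℝ, E) ∞ where
  exists_contMDiffCoordChange := by
    rintro _ ⟨m, rfl⟩ _ ⟨m', rfl⟩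
    exact ⟨verticalCoordChange hp m m', contMDiffOn_verticalCoordChange hp m m',
      fun y hy w ↦ verticalCoordChange_apply hp m m' hy.1 hy.2 w⟩

instance : TopologicalSpace (TotalSpace F (Vertical hp)) :=
  (verticalPrebundle hp).totalSpaceTopology

instance : FiberBundle F (Vertical hp) := (verticalPrebundle hp).toFiberBundle

instance : VectorBundle ℝ F (Vertical hp) := (verticalPrebundle hp).toVectorBundle

instance : ContMDiffVectorBundle ∞ F (Vertical hp) 𝓘(ℝ, E) :=
  (verticalPrebundle hp).contMDiffVectorBundle 𝓘(ℝ, E)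

theorem mfderiv_fibreIncl_mem (x : N) (y : Fibre hp x) (v : TangentSpace 𝓘(ℝ, F) y) :
    mfderiv 𝓘(ℝ, F) 𝓘(ℝ, E) (fibreIncl hp x) y v ∈
      (mfderiv 𝓘(ℝ, E) 𝓘(ℝ, E') p (fibreIncl hp x y)).ker := by
  have h1 : MDifferentiableAt 𝓘(ℝ, F) 𝓘(ℝ, E) (fibreIncl hp x) y :=
    (contMDiff_fibreIncl hp x y).mdifferentiableAt (by simp)
  have h2 : MDifferentiableAt 𝓘(ℝ, E) 𝓘(ℝ, E') p (fibreIncl hp x y) :=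
    (hp.contMDiff _).mdifferentiableAt (by simp)
  have h3 := h2.hasMFDerivAt.comp y h1.hasMFDerivAt
  have h4 : p ∘ fibreIncl hp x = fun _ ↦ x := funext fun z ↦ z.2
  rw [h4] at h3
  exact DFunLike.congr_fun (hasMFDerivAt_unique h3 (hasMFDerivAt_const x y)) v

/-- The tangent map of the inclusion of a fibre, as a map into the vertical bundle. -/
def fibreTangentIncl (x : N) (v : TangentBundle 𝓘(ℝ, F) (Fibre hp x)) :
    TotalSpace F (Vertical hp) :=
  ⟨fibreIncl hp x v.1, ⟨mfderiv 𝓘(ℝ, F) 𝓘(ℝ, E) (fibreIncl hp x) v.1 v.2,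
    mfderiv_fibreIncl_mem hp x v.1 v.2⟩⟩

end

end Submersion

/-! ### Sprays on anchored bundles -/

section AnchoredBundle

variable {E F : Type*} [NormedAddCommGroup E] [NormedSpace ℝ E]
  [NormedAddCommGroup F] [NormedSpace ℝ F]
  {M : Type*} [TopologicalSpace M] [ChartedSpace E M] [IsManifold 𝓘(ℝ, E) ∞ M]
  {V : M → Type*} [TopologicalSpace (TotalSpace F V)] [∀ m, AddCommGroup (V m)]
  [∀ m, Module ℝ (V m)] [∀ m, TopologicalSpace (V m)] [FiberBundle F V] [VectorBundle ℝ F V]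
  [ContMDiffVectorBundle ∞ F V 𝓘(ℝ, E)]

/-- Fibrewise multiplication with the scalar `a` on a vector bundle. -/
def bundleScale (a : ℝ) (v : TotalSpace F V) : TotalSpace F V := ⟨v.proj, a • v.2⟩

/-- `S` is a spray on the vector bundle `V` over `M` with anchor `ρ`: a smooth vector field on the
total space of `V` with `Tπ ∘ S = ρ` and `S ∘ h_a = T h_a (a S)` for all real `a`. -/
structure IsSpray (ρ : ∀ m, V m →L[ℝ] TangentSpace 𝓘(ℝ, E) m)
    (S : ∀ v : TotalSpace F V, TangentSpace (𝓘(ℝ, E).prod 𝓘(ℝ, F)) v) : Prop where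
  contMDiff : ContMDiff (𝓘(ℝ, E).prod 𝓘(ℝ, F)) (𝓘(ℝ, E).prod 𝓘(ℝ, F)).tangent ∞
    fun v ↦ (⟨v, S v⟩ : TangentBundle (𝓘(ℝ, E).prod 𝓘(ℝ, F)) (TotalSpace F V))
  lifts_anchor : ∀ v : TotalSpace F V,
    mfderiv (𝓘(ℝ, E).prod 𝓘(ℝ, F)) 𝓘(ℝ, E) (π F V) v (S v) = ρ v.proj v.2
  homogeneous : ∀ (a : ℝ) (v : TotalSpace F V),
    S (bundleScale a v) =
      mfderiv (𝓘(ℝ, E).prod 𝓘(ℝ, F)) (𝓘(ℝ, E).prod 𝓘(ℝ, F)) (bundleScale a) v (a • S v)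

/-- `w` is the value at time `1` of the flow of the vector field `S` started at `v`: there is an
integral curve of `S`, on an open interval containing `[0, 1]`, from `v` to `w`. -/
def IsTimeOneFlow (S : ∀ v : TotalSpace F V, TangentSpace (𝓘(ℝ, E).prod 𝓘(ℝ, F)) v)
    (v w : TotalSpace F V) : Prop :=
  ∃ (γ : ℝ → TotalSpace F V) (a b : ℝ), a < 0 ∧ 1 < b ∧
    IsMIntegralCurveOn (I := 𝓘(ℝ, E).prod 𝓘(ℝ, F)) γ S (Ioo a b) ∧ γ 0 = v ∧ γ 1 = w

/-- The domain of the spray exponential map: the flow of `S` is defined up to time `1`. -/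
def expDomain (S : ∀ v : TotalSpace F V, TangentSpace (𝓘(ℝ, E).prod 𝓘(ℝ, F)) v) :
    Set (TotalSpace F V) :=
  {v | ∃ w, IsTimeOneFlow S v w}

open Classical in
/-- The spray exponential map `π ∘ Fl₁` (with an irrelevant value outside of its domain). -/
def sprayExp (S : ∀ v : TotalSpace F V, TangentSpace (𝓘(ℝ, E).prod 𝓘(ℝ, F)) v)
    (v : TotalSpace F V) : M :=
  if h : ∃ w, IsTimeOneFlow S v w then h.choose.proj else v.proj

end AnchoredBundle

/-! ### Local additions -/

section LocalAddition

variable {E E' F : Type*} [NormedAddCommGroup E] [NormedSpace ℝ E]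
  [NormedAddCommGroup E'] [NormedSpace ℝ E'] [NormedAddCommGroup F] [NormedSpace ℝ F]
  {M N : Type*} [TopologicalSpace M] [ChartedSpace E M] [TopologicalSpace N] [ChartedSpace E' N]
  {p : M → N}

/-- `(U, Ψ)` is a local addition on the submersion `p`: `U` is an open neighbourhood of the zero
section in the vertical bundle and `Ψ` is an open embedding of `U` into `M ×_p M`, that is, a
diffeomorphism onto an open subset, with `Ψ (0_m) = (m, m)` and `pr₁ ∘ Ψ = π`. -/
structure IsLocalAddition (hp : IsSubmersionOfComplement F 𝓘(ℝ, E) 𝓘(ℝ, E') ∞ p)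
    (U : TopologicalSpace.Opens (TotalSpace F (Vertical hp))) (Ψ : U → FibreProduct hp) :
    Prop where
  zero_mem : ∀ m : M, zeroSection F (Vertical hp) m ∈ U
  isOpenEmbedding : IsOpenEmbedding Ψ
  isLocalDiffeomorph :
    IsLocalDiffeomorph (𝓘(ℝ, E).prod 𝓘(ℝ, F)) 𝓘(ℝ, E × F) ∞ Ψ
  apply_zero : ∀ m : M, (Ψ ⟨zeroSection F (Vertical hp) m, zero_mem m⟩).fst = m ∧
    (Ψ ⟨zeroSection F (Vertical hp) m, zero_mem m⟩).snd = m
  fst_apply : ∀ u : U, (Ψ u).fst = (u : TotalSpace F (Vertical hp)).proj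

variable (E M) in
/-- `M` is `C^∞`-paracompact: it is paracompact and every open cover of `M` admits a subordinate
smooth partition of unity. -/
def SmoothlyParacompact : Prop :=
  ParacompactSpace M ∧ ∀ 𝒰 : Set (Set M), (∀ u ∈ 𝒰, IsOpen u) → ⋃₀ 𝒰 = univ →
    ∃ f : SmoothPartitionOfUnity 𝒰 𝓘(ℝ, E) M univ, f.IsSubordinate fun u ↦ (u : Set M)

end LocalAddition

end Spray

end

/-! Everything rests on the form of a vertical spray in submersion charts. With `E ≅ E' × F`, a
vertical vector has coordinates `(y, w)` with `w` in `F`. The anchor condition forces the principal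
part of `S` to be `((0, w), Γ(y, w))`, and homogeneity gives `Γ(y, a w) = a² Γ(y, w)`.

For (a), the tangent map of a fibre inclusion is an injective affine map in charts, and at its image
`S` has no component in `E'`, so `S` lies in the image of the differential. This determines the
restricted field (`IsSpray.mfderiv_restrictSprayAt`). Its independence of the chart, the spray
axioms and uniqueness all follow from `mfderiv_fibreTangentIncl_injective`.

For (b), a spray exists because the spray axioms survive averaging flat chart sprays with weights
pulled back from `M` (`exists_isSpray`). For the exponential map, `Γ` is quadratic in `w`, so the
linearisation of `S` at a zero vector is `A (u, w) = ((0, w), 0)`, which satisfies `A² = 0`. The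
integral equation of the flow is then linearised by `id - N` with `N² = 0`, which is invertible
whatever the length of the time interval. The inverse function theorem in a Banach space of curves
thus gives a flow beyond time `1`, smooth in the initial value, with time-one derivative `id + A`
(`exists_flow_of_sq_fderiv_eq_zero`). The `E'`-coordinate of the base point is constant along this
flow, so `exp` preserves the fibres of `p`. In charts, `(π, exp)` has derivative `(u, w) ↦ (u, L u +
w)` at a zero vector, where `L` takes the `F`-component, so it is a local diffeomorphism there.

The local inverses are glued over a locally finite closed cover of `M`. Since `(π, exp)` remembers
the base point, injectivity only concerns vectors over one point, and these lie in one common local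
domain (`IsSpray.exists_isLocalAddition`). -/

set_option linter.unusedSectionVars false

noncomputable section

namespace Spray

/-! ### Smoothness of composition operators on spaces of continuous curves -/

section Superposition

universe u
variable {K : Type*} [TopologicalSpace K] [CompactSpace K]
  {V : Type*} [NormedAddCommGroup V] [NormedSpace ℝ V]
  {W : Type*} [NormedAddCommGroup W] [NormedSpace ℝ W]

open Classical in
/-- The superposition operator `γ ↦ g ∘ γ` (with value `0` where `g ∘ γ` is not continuous). -/
def superpose (g : V → W) (γ : C(K, V)) : C(K, W) :=
  if h : Continuous (g ∘ γ) then ⟨g ∘ γ, h⟩ else 0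

/-- The continuous maps with values in `Ω`. -/
def curvesIn (K : Type*) [TopologicalSpace K] (Ω : Set V) : Set C(K, V) := {γ | ∀ t, γ t ∈ Ω}

theorem isOpen_curvesIn {Ω : Set V} (hΩ : IsOpen Ω) : IsOpen (curvesIn K Ω) := by
  have := ContinuousMap.isOpen_setOfPred_mapsTo (isCompact_univ (X := K)) hΩ
  simpa [MapsTo, curvesIn] using this

theorem superpose_apply {g : V → W} {Ω : Set V} (hg : ContinuousOn g Ω) {γ : C(K, V)}
    (hγ : γ ∈ curvesIn K Ω) (t : K) : superpose g γ t = g (γ t) := by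
  have h : Continuous (g ∘ γ) := hg.comp_continuous γ.continuous hγ
  simp [superpose, h]

/-- Compactness of `K` turns continuity of `g` at the points `γ t` into the uniform estimate that
convergence in `C(K, W)` requires. -/
theorem continuousOn_superpose {g : V → W} {Ω : Set V} (hΩ : IsOpen Ω) (hg : ContinuousOn g Ω) :
    ContinuousOn (superpose g : C(K, V) → C(K, W)) (curvesIn K Ω) := by
  intro γ hγ
  refine ContinuousAt.continuousWithinAt ?_
  rw [ContinuousAt, ContinuousMap.tendsto_iff_tendstoUniformly, Metric.tendstoUniformly_iff]
  intro ε hε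
  have h1 : ∀ t : K, ∀ᶠ q : C(K, V) × K in 𝓝 γ ×ˢ 𝓝 t, dist (g (γ q.2)) (g (q.1 q.2)) < ε := by
    intro t
    have hgt : ContinuousAt g (γ t) := hg.continuousAt (hΩ.mem_nhds (hγ t))
    have h2 : Filter.Tendsto (fun q : C(K, V) × K ↦ g (γ q.2)) (𝓝 (γ, t)) (𝓝 (g (γ t))) :=
      Filter.Tendsto.comp hgt ((γ.continuous.comp continuous_snd).tendsto (γ, t))
    have h3 : Filter.Tendsto (fun q : C(K, V) × K ↦ g (q.1 q.2)) (𝓝 (γ, t)) (𝓝 (g (γ t))) := by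
      refine Filter.Tendsto.comp hgt ?_
      have : Continuous fun q : C(K, V) × K ↦ q.1 q.2 := by fun_prop
      exact this.tendsto (γ, t)
    have h4 := h2.dist h3
    rw [dist_self] at h4
    rw [← nhds_prod_eq]
    exact h4.eventually (gt_mem_nhds hε)
  have h5 := isCompact_univ.eventually_forall_of_forall_eventually
    (x₀ := γ) (P := fun (γ' : C(K, V)) (t : K) ↦ dist (g (γ t)) (g (γ' t)) < ε)
    fun t _ ↦ by rw [nhds_prod_eq]; exact h1 t
  filter_upwards [h5, (isOpen_curvesIn hΩ).mem_nhds hγ] with γ' h6 h7 t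
  rw [superpose_apply hg hγ, superpose_apply hg h7]
  exact h6 t (mem_univ t)

set_option synthInstance.maxHeartbeats 200000 in
variable (K V W) in
/-- Pointwise application of a continuous family of operators. -/
def pointwiseApply : C(K, V →L[ℝ] W) →L[ℝ] C(K, V) →L[ℝ] C(K, W) :=
  LinearMap.mkContinuous₂
    (LinearMap.mk₂ ℝ (fun (A : C(K, V →L[ℝ] W)) (η : C(K, V)) ↦
      (⟨fun t ↦ A t (η t), by fun_prop⟩ : C(K, W)))
      (fun A B η ↦ by ext; simp) (fun a A η ↦ by ext; simp)
      (fun A η ζ ↦ by ext; simp) (fun a A η ↦ by ext; simp)) 1 fun A η ↦ by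
    rw [one_mul, ContinuousMap.norm_le _ (by positivity)]
    intro t
    exact (A t).le_of_opNorm_le_of_le (A.norm_coe_le_norm t) (η.norm_coe_le_norm t)

@[simp]
theorem pointwiseApply_apply (A : C(K, V →L[ℝ] W)) (η : C(K, V)) (t : K) :
    pointwiseApply K V W A η t = A t (η t) := rfl

-- The candidate derivative multiplies pointwise by `fderiv ℝ g (γ t)`. Compactness makes the
-- continuity of `fderiv ℝ g` uniform along `γ`, and the mean value inequality then bounds the
-- remainder uniformly in `t`.
set_option synthInstance.maxHeartbeats 200000 in
theorem hasFDerivAt_superpose {g : V → W} {Ω : Set V} (hΩ : IsOpen Ω) (hg : ContDiffOn ℝ 1 g Ω)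
    {γ : C(K, V)} (hγ : γ ∈ curvesIn K Ω) :
    HasFDerivAt (superpose g) (pointwiseApply K V W (superpose (fderiv ℝ g) γ)) γ := by
  have hg' : ContinuousOn (fderiv ℝ g) Ω := hg.continuousOn_fderiv_of_isOpen hΩ le_rfl
  have hd : ∀ v ∈ Ω, DifferentiableAt ℝ g v := fun v hv ↦
    (hg.differentiableOn one_ne_zero).differentiableAt (hΩ.mem_nhds hv)
  rw [hasFDerivAt_iff_isLittleO_nhds_zero, Asymptotics.isLittleO_iff]
  intro ε hε
  have h1 : ∀ᶠ r : V in 𝓝 0, ∀ t ∈ (univ : Set K), γ t + r ∈ Ω ∧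
      ‖fderiv ℝ g (γ t + r) - fderiv ℝ g (γ t)‖ ≤ ε := by
    refine isCompact_univ.eventually_forall_of_forall_eventually fun t _ ↦ ?_
    have h2 : Filter.Tendsto (fun q : V × K ↦ γ q.2 + q.1) (𝓝 (0, t)) (𝓝 (γ t)) := by
      have : Continuous fun q : V × K ↦ γ q.2 + q.1 := by fun_prop
      simpa using this.tendsto (0, t)
    have h3 : Filter.Tendsto (fun q : V × K ↦ γ q.2) (𝓝 (0, t)) (𝓝 (γ t)) :=
      (γ.continuous.comp continuous_snd).tendsto (0, t)
    have hgt : ContinuousAt (fderiv ℝ g) (γ t) := hg'.continuousAt (hΩ.mem_nhds (hγ t))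
    have h4 := ((Filter.Tendsto.comp hgt h2).sub (Filter.Tendsto.comp hgt h3)).norm
    rw [sub_self, norm_zero] at h4
    filter_upwards [h2.eventually (hΩ.mem_nhds (hγ t)), h4.eventually (gt_mem_nhds hε)]
      with q h5 h6
    exact ⟨h5, h6.le⟩
  obtain ⟨δ, hδ, h2⟩ := Metric.eventually_nhds_iff_ball.1 h1
  filter_upwards [Metric.ball_mem_nhds (0 : C(K, V)) hδ] with η hη
  rw [mem_ball_zero_iff] at hη
  rw [ContinuousMap.norm_le _ (by positivity)]
  intro t
  have hηt : ‖η t‖ < δ := (η.norm_coe_le_norm t).trans_lt hη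
  have hmem : γ + η ∈ curvesIn K Ω := fun s ↦
    (h2 (η s) (by simpa using (η.norm_coe_le_norm s).trans_lt hη) s (mem_univ s)).1
  -- The mean value inequality for `g` minus its linear part at `γ t`, on a ball whose radius `δ`
  -- does not depend on `t`.
  have h3 := (convex_ball (γ t) δ).norm_image_sub_le_of_norm_hasFDerivWithin_le'
    (f := g) (f' := fderiv ℝ g) (φ := fderiv ℝ g (γ t)) (C := ε) (x := γ t) (y := γ t + η t)
    (fun v hv ↦ ?_) (fun v hv ↦ ?_) (Metric.mem_ball_self hδ) (by simpa using hηt)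
  · rw [add_sub_cancel_left] at h3
    simp only [ContinuousMap.sub_apply, pointwiseApply_apply]
    rw [superpose_apply hg.continuousOn hmem, superpose_apply hg.continuousOn hγ,
      superpose_apply hg' hγ]
    exact h3.trans (by gcongr; exact η.norm_coe_le_norm t)
  · have := h2 (v - γ t) (by simpa [dist_eq_norm] using hv) t (mem_univ t)
    rw [add_sub_cancel] at this
    exact (hd v this.1).hasFDerivAt.hasFDerivWithinAt
  · have := h2 (v - γ t) (by simpa [dist_eq_norm] using hv) t (mem_univ t)
    rw [add_sub_cancel] at this
    exact this.2

-- The derivative of a superposition operator is a bounded linear map applied to another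
-- superposition operator, that of `fderiv ℝ g`, so one induction gives all orders. The target `W`
-- varies in the induction; `V` and `W` share a universe so that `V →L[ℝ] W` is again an admissible
-- target.
set_option synthInstance.maxHeartbeats 200000 in
theorem contDiffOn_superpose_nat (V : Type u) [NormedAddCommGroup V] [NormedSpace ℝ V] {Ω : Set V}
    (hΩ : IsOpen Ω) (n : ℕ) :
    ∀ (W : Type u) [NormedAddCommGroup W] [NormedSpace ℝ W] (g : V → W), ContDiffOn ℝ n g Ω →
      ContDiffOn ℝ n (superpose g : C(K, V) → C(K, W)) (curvesIn K Ω) := by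
  induction n with
  | zero =>
    intro W _ _ g hg
    simp only [Nat.cast_zero, contDiffOn_zero] at hg ⊢
    exact continuousOn_superpose hΩ hg
  | succ n ih =>
    intro W _ _ g hg
    have h1 : ContDiffOn ℝ 1 g Ω := hg.of_le (by norm_cast; omega)
    have hd : ∀ γ ∈ curvesIn K Ω, HasFDerivAt (superpose g)
        (pointwiseApply K V W (superpose (fderiv ℝ g) γ)) γ :=
      fun γ hγ ↦ hasFDerivAt_superpose hΩ h1 hγ
    rw [Nat.cast_succ, contDiffOn_succ_iff_fderiv_of_isOpen (isOpen_curvesIn hΩ)]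
    refine ⟨fun γ hγ ↦ (hd γ hγ).differentiableAt.differentiableWithinAt, by simp, ?_⟩
    have h2 := ih (V →L[ℝ] W) (fderiv ℝ g) (hg.fderiv_of_isOpen hΩ (by norm_cast))
    have h3 : ContDiffOn ℝ n (fun γ ↦ pointwiseApply K V W (superpose (fderiv ℝ g) γ))
        (curvesIn K Ω) := by
      have h4 : ContDiff ℝ n (pointwiseApply K V W) := by fun_prop
      exact h4.comp_contDiffOn h2
    exact h3.congr fun γ hγ ↦ (hd γ hγ).fderiv

theorem contDiffOn_superpose {V W : Type u} [NormedAddCommGroup V] [NormedSpace ℝ V]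
    [NormedAddCommGroup W] [NormedSpace ℝ W] {Ω : Set V} (hΩ : IsOpen Ω) {g : V → W}
    (hg : ContDiffOn ℝ ∞ g Ω) :
    ContDiffOn ℝ ∞ (superpose g : C(K, V) → C(K, W)) (curvesIn K Ω) :=
  contDiffOn_infty.2 fun n ↦ contDiffOn_superpose_nat V hΩ n W g (contDiffOn_infty.1 hg n)

end Superposition

/-- The inverse function theorem, with an inverse that is smooth on its whole domain. -/
theorem exists_openPartialHomeomorph_contDiffOn_symm {X Y : Type*} [NormedAddCommGroup X]
    [NormedSpace ℝ X] [CompleteSpace X] [NormedAddCommGroup Y] [NormedSpace ℝ Y] {f : X → Y}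
    {s : Set X} {a : X} (hs : IsOpen s) (ha : a ∈ s) (hf : ContDiffOn ℝ ∞ f s) {f' : X ≃L[ℝ] Y}
    (hf' : HasFDerivAt f (f' : X →L[ℝ] Y) a) :
    ∃ e : OpenPartialHomeomorph X Y, a ∈ e.source ∧ e.source ⊆ s ∧ (e : X → Y) = f ∧
      ContDiffOn ℝ ∞ e.symm e.target := by
  have hfa : ContDiffAt ℝ ∞ f a := hf.contDiffAt (hs.mem_nhds ha)
  let e := hfa.toOpenPartialHomeomorph f hf' (by simp)
  have hae : a ∈ e.source := hfa.mem_toOpenPartialHomeomorph_source hf' (by simp)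
  have hef : (e : X → Y) = f := hfa.toOpenPartialHomeomorph_coe hf' (by simp)
  have hc : ContinuousAt (fderiv ℝ f) a :=
    (hf.continuousOn_fderiv_of_isOpen hs (by simp)).continuousAt (hs.mem_nhds ha)
  -- Invertible operators form an open set, so near `a` every derivative of `f` is invertible, and
  -- the inverse is smooth at every point of the shrunken target.
  have h1 : ∀ᶠ x in 𝓝 a, fderiv ℝ f x ∈ range ((↑) : (X ≃L[ℝ] Y) → X →L[ℝ] Y) := by
    refine hc.eventually ?_
    rw [hf'.fderiv]
    exact ContinuousLinearEquiv.nhds f'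
  obtain ⟨O, hO, hOo, haO⟩ := eventually_nhds_iff.1 (h1.and (hs.mem_nhds ha))
  refine ⟨e.restrOpen O hOo, ⟨hae, haO⟩, fun x hx ↦ (hO x hx.2).2, hef, fun y hy ↦ ?_⟩
  have hy' : (e.restrOpen O hOo).symm y ∈ O := ((e.restrOpen O hOo).map_target hy).2
  obtain ⟨⟨f'', hf''⟩, hys⟩ := hO _ hy'
  have h2 : ContDiffAt ℝ ∞ f ((e.restrOpen O hOo).symm y) := hf.contDiffAt (hs.mem_nhds hys)
  refine ((e.restrOpen O hOo).contDiffAt_symm hy (f₀' := f'') ?_ ?_).contDiffWithinAt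
  · rw [hf'']
    exact (h2.differentiableAt (by simp)).hasFDerivAt
  · exact h2

/-! ### Flows near a zero whose linearisation squares to zero -/

section Flow

universe u
variable {V : Type u} [NormedAddCommGroup V] [NormedSpace ℝ V]

/-- The compact time interval `[-1, 2]` on which curves are considered. -/
abbrev TimeInterval : Type := Icc (-1 : ℝ) 2

/-- A continuous curve on `[-1, 2]`, extended by constants to the real line. -/
def extendCurve (γ : C(TimeInterval, V)) : ℝ → V := IccExtend (by norm_num) γ

theorem continuous_extendCurve (γ : C(TimeInterval, V)) : Continuous (extendCurve γ) :=
  γ.continuous.Icc_extend'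

theorem extendCurve_coe (γ : C(TimeInterval, V)) (t : TimeInterval) :
    extendCurve γ t = γ t := IccExtend_val _ _ t

theorem norm_extendCurve_le (γ : C(TimeInterval, V)) (t : ℝ) : ‖extendCurve γ t‖ ≤ ‖γ‖ :=
  γ.norm_coe_le_norm _

variable (V) in
/-- Integration of curves from time `0`. -/
def primitive : C(TimeInterval, V) →L[ℝ] C(TimeInterval, V) :=
  LinearMap.mkContinuous
    { toFun := fun γ ↦ ⟨fun t ↦ ∫ s in (0 : ℝ)..t, extendCurve γ s,
        (intervalIntegral.continuous_primitive
          (fun _ _ ↦ (continuous_extendCurve γ).intervalIntegrable _ _) 0).comp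
          continuous_subtype_val⟩
      map_add' := fun γ η ↦ by
        ext t
        exact intervalIntegral.integral_add ((continuous_extendCurve γ).intervalIntegrable _ _)
          ((continuous_extendCurve η).intervalIntegrable _ _)
      map_smul' := fun a γ ↦ by
        ext t
        exact intervalIntegral.integral_smul a _ } 2 fun γ ↦ by
    rw [ContinuousMap.norm_le _ (by positivity)]
    intro t
    refine (intervalIntegral.norm_integral_le_of_norm_le_const
      fun s _ ↦ norm_extendCurve_le γ s).trans ?_
    have h : |(t : ℝ) - 0| ≤ 2 := by
      rw [sub_zero, abs_le]
      exact ⟨by linarith [t.2.1], t.2.2⟩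
    rw [mul_comm]
    gcongr

/-- Integration commutes with a bounded operator. This lets the nilpotency of `A` pass to the
operator `γ ↦ ∫ A γ` on curves. -/
theorem primitive_comp_comm [CompleteSpace V] (A : V →L[ℝ] V) (γ : C(TimeInterval, V)) :
    primitive V (A.compLeftContinuous ℝ TimeInterval γ) =
      A.compLeftContinuous ℝ TimeInterval (primitive V γ) := by
  ext t
  exact A.intervalIntegral_comp_comm ((continuous_extendCurve γ).intervalIntegrable _ _)

/-- The flow, on the time interval `(-1, 2)`, of a smooth vector field `g` near a zero `z₀` of `g`
at which the linearisation `A` of `g` satisfies `A ∘ A = 0`. -/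
theorem exists_flow_of_sq_fderiv_eq_zero [CompleteSpace V] {Ω : Set V} (hΩ : IsOpen Ω)
    {g : V → V} (hg : ContDiffOn ℝ ∞ g Ω) {z₀ : V} (hz₀ : z₀ ∈ Ω) (hgz : g z₀ = 0)
    {A : V →L[ℝ] V} (hA : HasFDerivAt g A z₀) (hAA : ∀ v, A (A v) = 0) :
    ∃ (O : Set V) (c : V → ℝ → V), IsOpen O ∧ z₀ ∈ O ∧
      (∀ z ∈ O, c z 0 = z) ∧
      (∀ z ∈ O, ∀ t ∈ Ioo (-1 : ℝ) 2, c z t ∈ Ω ∧ HasDerivAt (c z) (g (c z t)) t) ∧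
      ContDiffOn ℝ ∞ (fun z ↦ c z 1) O ∧
      HasFDerivAt (fun z ↦ c z 1) (ContinuousLinearMap.id ℝ V + A) z₀ := by
  let K := TimeInterval
  let J := primitive V
  let A' : C(K, V) →L[ℝ] C(K, V) := A.compLeftContinuous ℝ K
  -- The integral equation: `γ` solves `γ' = g ∘ γ`, `γ 0 = z` exactly when `T γ` is the constant
  -- curve `z`. The flow will be a local inverse of `T` restricted to constant curves.
  let T : C(K, V) → C(K, V) := fun γ ↦ γ - J (superpose g γ)
  let const : V →L[ℝ] C(K, V) :=
    LinearMap.mkContinuous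
      { toFun := fun v ↦ ContinuousMap.const K v
        map_add' := fun _ _ ↦ rfl
        map_smul' := fun _ _ ↦ rfl } 1 fun v ↦ by
      rw [one_mul, ContinuousMap.norm_le _ (norm_nonneg v)]
      exact fun _ ↦ le_rfl
  have hJA : ∀ γ, J (A' γ) = A' (J γ) := primitive_comp_comm A
  have hA'A' : ∀ γ, A' (A' γ) = 0 := fun γ ↦ by
    ext t
    exact hAA _
  have hsq : ∀ γ, J (A' (J (A' γ))) = 0 := fun γ ↦ by
    rw [← hJA, hA'A', map_zero, map_zero]
  -- For `N = J A'` with `N² = 0`, the inverse of `id - N` is `id + N`. No smallness of the time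
  -- interval is needed.
  let P : C(K, V) ≃L[ℝ] C(K, V) := ContinuousLinearEquiv.equivOfInverse
    (ContinuousLinearMap.id ℝ _ - J.comp A') (ContinuousLinearMap.id ℝ _ + J.comp A')
    (fun γ ↦ by simp [hsq]) (fun γ ↦ by simp [hsq])
  have hc0 : const z₀ ∈ curvesIn K Ω := fun _ ↦ hz₀
  have hgd : ContinuousOn (fderiv ℝ g) Ω := hg.continuousOn_fderiv_of_isOpen hΩ (by simp)
  have hT : ContDiffOn ℝ ∞ T (curvesIn K Ω) :=
    contDiff_id.contDiffOn.sub (J.contDiff.comp_contDiffOn (contDiffOn_superpose hΩ hg))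
  have hT' : HasFDerivAt T (P : C(K, V) →L[ℝ] C(K, V)) (const z₀) := by
    have h1 := hasFDerivAt_superpose (K := K) hΩ (hg.of_le (by simp)) hc0
    have h2 := (hasFDerivAt_id (const z₀)).sub (J.hasFDerivAt.comp (const z₀) h1)
    refine h2.congr_fderiv ?_
    ext η : 1
    have h3 : pointwiseApply K V V (superpose (fderiv ℝ g) (const z₀)) η = A' η := by
      ext t
      rw [pointwiseApply_apply, superpose_apply hgd hc0]
      change fderiv ℝ g z₀ (η t) = A (η t)
      rw [hA.fderiv]
    change η - J (pointwiseApply K V V (superpose (fderiv ℝ g) (const z₀)) η) = η - J (A' η)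
    rw [h3]
  have hT0 : T (const z₀) = const z₀ := by
    have : superpose g (const z₀) = (0 : C(K, V)) := by
      ext t
      rw [superpose_apply hg.continuousOn hc0]
      exact hgz
    simp [T, this]
  obtain ⟨e, he0, hes, heT, hsymm⟩ :=
    exists_openPartialHomeomorph_contDiffOn_symm (isOpen_curvesIn hΩ) hc0 hT hT'
  let one : K := ⟨1, by norm_num, by norm_num⟩
  let O := const ⁻¹' e.target
  have hmem : ∀ z ∈ O, e.symm (const z) ∈ curvesIn K Ω := fun z hz ↦ hes (e.map_target hz)
  have heq : ∀ z ∈ O, ∀ t : K, e.symm (const z) t =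
      z + ∫ s in (0 : ℝ)..t, extendCurve (superpose g (e.symm (const z))) s := by
    intro z hz t
    have h1 : T (e.symm (const z)) = const z := by rw [← heT]; exact e.right_inv hz
    have h2 := DFunLike.congr_fun h1 t
    exact sub_eq_iff_eq_add.1 h2
  have hzero : z₀ ∈ O := by
    have := e.map_source he0
    rwa [heT, hT0] at this
  let ev : C(K, V) →L[ℝ] V := ContinuousMap.evalCLM ℝ one
  have hfun : ∀ z ∈ O, z + ∫ s in (0 : ℝ)..1, extendCurve (superpose g (e.symm (const z))) s =
      ev (e.symm (const z)) := fun z hz ↦ (heq z hz one).symm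
  -- The curve is given by its integral formula, which makes sense for all real `t` and is
  -- differentiable by the fundamental theorem of calculus; on `[-1, 2]` it agrees with the curve
  -- found by inverting `T`.
  refine ⟨O, fun z t ↦ z + ∫ s in (0 : ℝ)..t, extendCurve (superpose g (e.symm (const z))) s,
    e.open_target.preimage const.continuous, hzero, fun z _ ↦ by simp, fun z hz t ht ↦ ?_, ?_, ?_⟩
  · have ht' : t ∈ Icc (-1 : ℝ) 2 := Ioo_subset_Icc_self ht
    have h1 := heq z hz ⟨t, ht'⟩
    beta_reduce
    simp only at h1
    refine ⟨by rw [← h1]; exact hmem z hz _, ?_⟩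
    have h2 := (continuous_extendCurve (superpose g (e.symm (const z)))).integral_hasStrictDerivAt
      0 t |>.hasDerivAt.const_add z
    rw [← h1, ← superpose_apply hg.continuousOn (hmem z hz), ← extendCurve_coe]
    exact h2
  · refine ContDiffOn.congr (f := fun z ↦ ev (e.symm (const z))) ?_ hfun
    exact ev.contDiff.comp_contDiffOn (hsymm.comp const.contDiff.contDiffOn fun _ h ↦ h)
  · have h1 : HasFDerivAt e.symm (P.symm : C(K, V) →L[ℝ] C(K, V)) (const z₀) := by
      have h2 : e.symm (const z₀) = const z₀ := by
        conv_lhs => rw [← hT0, ← heT]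
        exact e.left_inv he0
      refine e.hasFDerivAt_symm hzero ?_
      rw [heT, h2]
      exact hT'
    have h2 := ev.hasFDerivAt.comp z₀ (h1.comp z₀ const.hasFDerivAt)
    have h3 : (fun z ↦ z + ∫ s in (0 : ℝ)..1, extendCurve (superpose g (e.symm (const z))) s)
        =ᶠ[𝓝 z₀] fun z ↦ ev (e.symm (const z)) := by
      filter_upwards [(e.open_target.preimage const.continuous).mem_nhds hzero] with z hz
      exact hfun z hz
    refine (h2.congr_of_eventuallyEq h3).congr_fderiv ?_
    ext v
    -- The derivative is `id + J A'` applied to the constant curve `v` and evaluated at time `1`;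
    -- the integrand is the constant `A v`.
    change v + ∫ s in (0 : ℝ)..1, extendCurve (A' (const v)) s = v + A v
    have h4 : extendCurve (A' (const v)) = fun _ ↦ A v := rfl
    simp [h4]

end Flow

/-! ### Smoothness of tangent maps along sections -/

section TangentMaps

variable {B B' B'' : Type*} [NormedAddCommGroup B] [NormedSpace ℝ B]
  [NormedAddCommGroup B'] [NormedSpace ℝ B'] [NormedAddCommGroup B''] [NormedSpace ℝ B'']
  {H H' H'' : Type*} [TopologicalSpace H] [TopologicalSpace H'] [TopologicalSpace H'']
  {I : ModelWithCorners ℝ B H} {I' : ModelWithCorners ℝ B' H'} {J : ModelWithCorners ℝ B'' H''}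
  {X Y Z : Type*} [TopologicalSpace X] [ChartedSpace H X] [TopologicalSpace Y] [ChartedSpace H' Y]
  [TopologicalSpace Z] [ChartedSpace H'' Z]

theorem tangentBundle_mk_eq {x y : X} (h : x = y) (w : B) :
    (⟨x, w⟩ : TangentBundle I X) = ⟨y, w⟩ := by
  subst h
  rfl

theorem contMDiffOn_mfderiv_apply [IsManifold I ∞ X] [IsManifold I' ∞ Y] {f : X → Y} {s : Set X}
    (hs : IsOpen s) (hf : ContMDiffOn I I' ∞ f s) {t : Set Z} {σ : Z → X}
    {ξ : ∀ z, TangentSpace I (σ z)}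
    (hσ : ContMDiffOn J I.tangent ∞ (fun z ↦ (⟨σ z, ξ z⟩ : TangentBundle I X)) t)
    (ht : MapsTo σ t s) :
    ContMDiffOn J I'.tangent ∞
      (fun z ↦ (⟨f (σ z), mfderiv I I' f (σ z) (ξ z)⟩ : TangentBundle I' Y)) t := by
  have h1 := hf.contMDiffOn_tangentMapWithin (m := ∞) (by simp) hs.uniqueMDiffOn
  refine (h1.comp hσ fun z hz ↦ ht hz).congr fun z hz ↦ ?_
  simp only [comp_apply, tangentMapWithin, mfderivWithin_of_isOpen hs (ht hz)]

end TangentMaps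

end Spray

/-! ### Vector fields and their principal parts in charts -/

namespace PartialDiffeomorph

section Derivative

variable {B B' : Type*} [NormedAddCommGroup B] [NormedSpace ℝ B]
  [NormedAddCommGroup B'] [NormedSpace ℝ B']
  {H H' : Type*} [TopologicalSpace H] [TopologicalSpace H']
  {I : ModelWithCorners ℝ B H} {I' : ModelWithCorners ℝ B' H'}
  {X Y : Type*} [TopologicalSpace X] [ChartedSpace H X] [TopologicalSpace Y] [ChartedSpace H' Y]
  (Φ : PartialDiffeomorph I I' X Y ∞)

theorem mdifferentiableAt_of_mem {x : X} (hx : x ∈ Φ.source) : MDifferentiableAt I I' Φ x :=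
  Φ.mdifferentiableAt (by simp) hx

theorem mdifferentiableAt_symm {y : Y} (hy : y ∈ Φ.target) : MDifferentiableAt I' I Φ.symm y :=
  Φ.symm.mdifferentiableAt (by simp) hy

theorem mfderiv_symm_mfderiv {x : X} (hx : x ∈ Φ.source) (v : TangentSpace I x) :
    mfderiv I' I Φ.symm (Φ x) (mfderiv I I' Φ x v) = v := by
  have h1 := (Φ.mdifferentiableAt_symm (Φ.map_source hx)).hasMFDerivAt.comp x
    (Φ.mdifferentiableAt_of_mem hx).hasMFDerivAt
  have h2 : (Φ.symm ∘ Φ : X → X) =ᶠ[𝓝 x] id := by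
    filter_upwards [Φ.open_source.mem_nhds hx] with z hz
    exact Φ.left_inv hz
  exact DFunLike.congr_fun
    (hasMFDerivAt_unique h1 ((hasMFDerivAt_id x).congr_of_eventuallyEq h2)) v

theorem mfderiv_mfderiv_symm {y : Y} (hy : y ∈ Φ.target) (w : TangentSpace I' y) :
    mfderiv I I' Φ (Φ.symm y) (mfderiv I' I Φ.symm y w) = w :=
  Φ.symm.mfderiv_symm_mfderiv hy w

theorem mfderiv_injective {x : X} (hx : x ∈ Φ.source) : Injective (mfderiv I I' Φ x) :=
  LeftInverse.injective (g := mfderiv I' I Φ.symm (Φ x)) (Φ.mfderiv_symm_mfderiv hx)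

/-- Here `Φ.symm (Φ x)` equals `x` only propositionally, so the vector is moved between the two
tangent spaces through their common model space. -/
theorem mfderiv_mfderiv_symm_apply {x : X} (hx : x ∈ Φ.source) (w : B') :
    mfderiv I I' Φ x (mfderiv I' I Φ.symm (Φ x) w : B) = w := by
  have h : ∀ y, y = x → ∀ u : B, (mfderiv I I' Φ y u : B') = mfderiv I I' Φ x u := by
    rintro _ rfl _
    rfl
  exact (h _ (Φ.left_inv hx) _).symm.trans (Φ.mfderiv_mfderiv_symm (Φ.map_source hx) w)

end Derivative

section VectorSpace

variable {B B' : Type*} [NormedAddCommGroup B] [NormedSpace ℝ B]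
  [NormedAddCommGroup B'] [NormedSpace ℝ B']
  {H : Type*} [TopologicalSpace H] {I : ModelWithCorners ℝ B H}
  {X : Type*} [TopologicalSpace X] [ChartedSpace H X] [IsManifold I ∞ X]
  (Φ : PartialDiffeomorph I 𝓘(ℝ, B') X B' ∞)

/-- The principal part of a vector field in a chart. -/
def principalPart (S : ∀ x : X, TangentSpace I x) (z : B') : B' :=
  mfderiv I 𝓘(ℝ, B') Φ (Φ.symm z) (S (Φ.symm z))

theorem principalPart_apply (S : ∀ x : X, TangentSpace I x) {x : X} (hx : x ∈ Φ.source) :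
    Φ.principalPart S (Φ x) = mfderiv I 𝓘(ℝ, B') Φ x (S x) := by
  have h : Φ.symm (Φ x) = x := Φ.left_inv hx
  simp only [principalPart]
  rw [h]

theorem contDiffOn_principalPart {S : ∀ x : X, TangentSpace I x}
    (hS : ContMDiff I I.tangent ∞ fun x ↦ (⟨x, S x⟩ : TangentBundle I X)) :
    ContDiffOn ℝ ∞ (Φ.principalPart S) Φ.target := by
  rw [← contMDiffOn_iff_contDiffOn]
  have h1 := Spray.contMDiffOn_mfderiv_apply Φ.open_source Φ.contMDiffOn
    (hS.contMDiffOn.comp Φ.symm.contMDiffOn (t := univ) fun _ _ ↦ mem_univ _)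
    (fun z hz ↦ Φ.map_target hz)
  exact (contMDiff_snd_tangentBundle_modelSpace B' 𝓘(ℝ, B')).comp_contMDiffOn h1

/-- Converse to `contDiffOn_principalPart`: a smooth principal part defines a smooth vector field.
Both flat sprays and restricted sprays are built this way. -/
theorem contMDiffOn_mfderiv_symm {h : B' → B'} (hh : ContDiffOn ℝ ∞ h Φ.target) :
    ContMDiffOn I I.tangent ∞ (fun x ↦ (⟨x, mfderiv 𝓘(ℝ, B') I Φ.symm (Φ x) (h (Φ x))⟩ :
      TangentBundle I X)) Φ.source := by
  have h1 : ContMDiffOn 𝓘(ℝ, B') 𝓘(ℝ, B').tangent ∞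
      (fun z ↦ (⟨z, h z⟩ : TangentBundle 𝓘(ℝ, B') B')) Φ.target :=
    contMDiffOn_vectorSpace_iff_contDiffOn.2 hh
  have h2 := Spray.contMDiffOn_mfderiv_apply (J := I) (σ := fun x ↦ Φ x) (ξ := fun x ↦ h (Φ x))
    Φ.open_target Φ.symm.contMDiffOn
    (h1.comp Φ.contMDiffOn fun x hx ↦ Φ.map_source hx) (fun x hx ↦ Φ.map_source hx)
  exact h2.congr fun x hx ↦ Spray.tangentBundle_mk_eq (Φ.left_inv hx).symm _

end VectorSpace

end PartialDiffeomorph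

namespace Spray

/-! ### Fibrewise multiplication -/

section BundleScale

variable {E F : Type*} [NormedAddCommGroup E] [NormedSpace ℝ E]
  [NormedAddCommGroup F] [NormedSpace ℝ F]
  {M : Type*} [TopologicalSpace M] [ChartedSpace E M] [IsManifold 𝓘(ℝ, E) ∞ M]
  {V : M → Type*} [TopologicalSpace (TotalSpace F V)] [∀ m, AddCommGroup (V m)]
  [∀ m, Module ℝ (V m)] [∀ m, TopologicalSpace (V m)] [FiberBundle F V] [VectorBundle ℝ F V]
  [ContMDiffVectorBundle ∞ F V 𝓘(ℝ, E)]

theorem contMDiff_bundleScale (a : ℝ) :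
    ContMDiff (𝓘(ℝ, E).prod 𝓘(ℝ, F)) (𝓘(ℝ, E).prod 𝓘(ℝ, F)) ∞
      (bundleScale a : TotalSpace F V → TotalSpace F V) := by
  intro v
  have hid := contMDiffAt_totalSpace.1
    (contMDiffAt_id (I := 𝓘(ℝ, E).prod 𝓘(ℝ, F)) (n := ∞) (x := v))
  refine contMDiffAt_totalSpace.2 ⟨hid.1, ?_⟩
  have h1 : ContMDiffAt (𝓘(ℝ, E).prod 𝓘(ℝ, F)) 𝓘(ℝ, F) ∞
      (fun w : TotalSpace F V ↦ a • (trivializationAt F V v.proj w).2) v :=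
    ((a • ContinuousLinearMap.id ℝ F).contMDiff (n := ∞)).contMDiffAt.comp v hid.2
  refine h1.congr_of_eventuallyEq ?_
  have h2 : π F V ⁻¹' (trivializationAt F V v.proj).baseSet ∈ 𝓝 v :=
    ((trivializationAt F V v.proj).open_baseSet.preimage
      (FiberBundle.continuous_proj F V)).mem_nhds (FiberBundle.mem_baseSet_trivializationAt' v.proj)
  filter_upwards [h2] with w hw
  exact ((trivializationAt F V v.proj).linear ℝ hw).map_smul a w.2

theorem mdifferentiable_bundleScale (a : ℝ) :
    MDifferentiable (𝓘(ℝ, E).prod 𝓘(ℝ, F)) (𝓘(ℝ, E).prod 𝓘(ℝ, F))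
      (bundleScale a : TotalSpace F V → TotalSpace F V) :=
  (contMDiff_bundleScale a).mdifferentiable (by simp)

end BundleScale

/-! ### Charts of the vertical bundle -/

section VerticalChart

variable {E E' F : Type*} [NormedAddCommGroup E] [NormedSpace ℝ E]
  [NormedAddCommGroup E'] [NormedSpace ℝ E'] [NormedAddCommGroup F] [NormedSpace ℝ F]
  {M N : Type*} [TopologicalSpace M] [ChartedSpace E M] [IsManifold 𝓘(ℝ, E) ∞ M]
  [TopologicalSpace N] [ChartedSpace E' N] [IsManifold 𝓘(ℝ, E') ∞ N]
  {p : M → N} (hp : IsSubmersionOfComplement F 𝓘(ℝ, E) 𝓘(ℝ, E') ∞ p)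

/-- The chart of the vertical bundle given by a submersion chart around `m`. -/
def verticalChart (m : M) : PartialDiffeomorph (𝓘(ℝ, E).prod 𝓘(ℝ, F)) 𝓘(ℝ, E × F)
    (TotalSpace F (Vertical hp)) (E × F) ∞ where
  toFun v := ((hp m).domChart v.proj, (verticalCoord hp m v).2)
  invFun z := (verticalPretrivialization hp m).toPartialEquiv.symm ((hp m).domChart.symm z.1, z.2)
  source := π F (Vertical hp) ⁻¹' (hp m).domChart.source
  target := (hp m).domChart.target ×ˢ univ
  map_source' v hv := ⟨(hp m).domChart.map_source hv, mem_univ _⟩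
  map_target' z hz := (verticalPretrivialization hp m).toPartialEquiv.map_target
    ⟨(hp m).domChart.map_target hz.1, mem_univ _⟩
  left_inv' v hv := by
    rw [(hp m).domChart.left_inv hv]
    exact (verticalPretrivialization hp m).toPartialEquiv.left_inv hv
  right_inv' z hz := by
    have h : verticalCoord hp m ((verticalPretrivialization hp m).toPartialEquiv.symm
        ((hp m).domChart.symm z.1, z.2)) = ((hp m).domChart.symm z.1, z.2) :=
      (verticalPretrivialization hp m).toPartialEquiv.right_inv
        ⟨(hp m).domChart.map_target hz.1, mem_univ _⟩
    have h2 := congrArg Prod.snd h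
    refine Prod.ext ?_ h2
    have h1 := congrArg Prod.fst h
    exact (congrArg (hp m).domChart h1).trans ((hp m).domChart.right_inv hz.1)
  open_source := (hp m).domChart.open_source.preimage
    (FiberBundle.continuous_proj F (Vertical hp))
  open_target := (hp m).domChart.open_target.prod isOpen_univ
  contMDiffOn_toFun := by
    have h1 : ContMDiffOn (𝓘(ℝ, E).prod 𝓘(ℝ, F)) (𝓘(ℝ, E).prod 𝓘(ℝ, F)) ∞ (verticalCoord hp m)
        (π F (Vertical hp) ⁻¹' (hp m).domChart.source) :=
      -- The preferred trivialisation at `m` has `verticalCoord hp m` as its underlying map by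
      -- construction.
      (trivializationAt F (Vertical hp) m).contMDiffOn
    exact ((contMDiffOn_of_mem_maximalAtlas (hp m).domChart_mem_maximalAtlas).comp
      (contMDiff_proj (Vertical hp)).contMDiffOn fun _ h ↦ h).prodMk_space
        (contMDiff_snd.comp_contMDiffOn h1)
  contMDiffOn_invFun := by
    have h1 : ContMDiffOn (𝓘(ℝ, E).prod 𝓘(ℝ, F)) (𝓘(ℝ, E).prod 𝓘(ℝ, F)) ∞
        (verticalPretrivialization hp m).toPartialEquiv.symm ((hp m).domChart.source ×ˢ univ) :=
      (trivializationAt F (Vertical hp) m).contMDiffOn_symm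
    have h2 : ContMDiff 𝓘(ℝ, E × F) 𝓘(ℝ, E) ∞ (Prod.fst : E × F → E) := contDiff_fst.contMDiff
    have h3 : ContMDiff 𝓘(ℝ, E × F) 𝓘(ℝ, F) ∞ (Prod.snd : E × F → F) := contDiff_snd.contMDiff
    exact h1.comp (((contMDiffOn_symm_of_mem_maximalAtlas
      (hp m).domChart_mem_maximalAtlas).comp h2.contMDiffOn fun _ h ↦ h.1).prodMk
        h3.contMDiffOn) fun z hz ↦ ⟨(hp m).domChart.map_target hz.1, mem_univ _⟩

theorem mem_verticalChart_source {m : M} {v : TotalSpace F (Vertical hp)} :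
    v ∈ (verticalChart hp m).source ↔ v.proj ∈ (hp m).domChart.source := Iff.rfl

theorem mem_verticalChart_target {m : M} {z : E × F} :
    z ∈ (verticalChart hp m).target ↔ z.1 ∈ (hp m).domChart.target := by
  simp [verticalChart]

theorem proj_verticalChart_symm (m : M) {z : E × F} (hz : z.1 ∈ (hp m).domChart.target) :
    ((verticalChart hp m).symm z).proj = (hp m).domChart.symm z.1 :=
  congrArg Prod.fst ((verticalPretrivialization hp m).toPartialEquiv.right_inv
    (x := ((hp m).domChart.symm z.1, z.2)) ⟨(hp m).domChart.map_target hz, mem_univ _⟩)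

theorem verticalChart_bundleScale (m : M) (a : ℝ) (v : TotalSpace F (Vertical hp)) :
    verticalChart hp m (bundleScale a v) =
      ((verticalChart hp m v).1, a • (verticalChart hp m v).2) := by
  refine Prod.ext rfl ?_
  let D : TangentSpace 𝓘(ℝ, E) v.proj →L[ℝ] E := mfderiv 𝓘(ℝ, E) 𝓘(ℝ, E) (hp m).domChart v.proj
  change ((hp m).equiv (D (verticalIncl hp v.proj (a • v.2)))).2 =
    a • ((hp m).equiv (D (verticalIncl hp v.proj v.2))).2
  simp only [map_smul, Prod.smul_snd]

theorem bundleScale_verticalChart_symm (m : M) (a : ℝ) {z : E × F}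
    (hz : z.1 ∈ (hp m).domChart.target) :
    bundleScale a ((verticalChart hp m).symm z) = (verticalChart hp m).symm (z.1, a • z.2) := by
  have hz' : z ∈ (verticalChart hp m).target := (mem_verticalChart_target hp).2 hz
  have hs : (verticalChart hp m).symm z ∈ (verticalChart hp m).source :=
    (verticalChart hp m).map_target hz'
  have hz'' : verticalChart hp m ((verticalChart hp m).symm z) = z :=
    (verticalChart hp m).right_inv hz'
  have h1 := verticalChart_bundleScale hp m a ((verticalChart hp m).symm z)
  rw [hz''] at h1
  rw [← h1]
  exact ((verticalChart hp m).left_inv (x := bundleScale a ((verticalChart hp m).symm z)) hs).symm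

/-- In the chart of a submersion, a vertical vector has the coordinates `(0, w)`. -/
theorem mfderiv_domChart_verticalIncl (m : M) {v : TotalSpace F (Vertical hp)}
    (hv : v.proj ∈ (hp m).domChart.source) :
    (mfderiv 𝓘(ℝ, E) 𝓘(ℝ, E) (hp m).domChart v.proj (verticalIncl hp v.proj v.2) : E) =
      (hp m).equiv.symm (0, (verticalChart hp m v).2) := by
  refine ((hp m).equiv.eq_symm_apply).2 (Prod.ext ?_ rfl)
  exact (mem_vertical_iff hp m hv _).1 v.2.2

/-- The first component of a tangent vector of the vertical bundle in a chart. -/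
theorem fst_mfderiv_verticalChart (m : M) {v : TotalSpace F (Vertical hp)}
    (hv : v.proj ∈ (hp m).domChart.source)
    (ξ : TangentSpace (𝓘(ℝ, E).prod 𝓘(ℝ, F)) v) :
    (mfderiv (𝓘(ℝ, E).prod 𝓘(ℝ, F)) 𝓘(ℝ, E × F) (verticalChart hp m) v ξ : E × F).1 =
      mfderiv 𝓘(ℝ, E) 𝓘(ℝ, E) (hp m).domChart v.proj
        (mfderiv (𝓘(ℝ, E).prod 𝓘(ℝ, F)) 𝓘(ℝ, E) (π F (Vertical hp)) v ξ) := by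
  have h1 := (ContinuousLinearMap.fst ℝ E F).hasMFDerivAt.comp v
    ((verticalChart hp m).mdifferentiableAt_of_mem (x := v) hv).hasMFDerivAt
  have h2 := (mdifferentiableAt_domChart hp m hv).hasMFDerivAt.comp v
    ((contMDiff_proj (n := ∞) (IB := 𝓘(ℝ, E)) (F := F) (Vertical hp)).mdifferentiable
      (by simp) v).hasMFDerivAt
  exact DFunLike.congr_fun (hasMFDerivAt_unique h1 h2) ξ

/-- The tangent map of fibrewise multiplication in a chart. -/
theorem mfderiv_verticalChart_bundleScale (m : M) (a : ℝ) {v : TotalSpace F (Vertical hp)}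
    (hv : v.proj ∈ (hp m).domChart.source)
    (ξ : TangentSpace (𝓘(ℝ, E).prod 𝓘(ℝ, F)) v) :
    (mfderiv (𝓘(ℝ, E).prod 𝓘(ℝ, F)) 𝓘(ℝ, E × F) (verticalChart hp m) (bundleScale a v)
      (mfderiv (𝓘(ℝ, E).prod 𝓘(ℝ, F)) (𝓘(ℝ, E).prod 𝓘(ℝ, F)) (bundleScale a) v ξ) : E × F) =
      ((mfderiv (𝓘(ℝ, E).prod 𝓘(ℝ, F)) 𝓘(ℝ, E × F) (verticalChart hp m) v ξ : E × F).1,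
        a • (mfderiv (𝓘(ℝ, E).prod 𝓘(ℝ, F)) 𝓘(ℝ, E × F) (verticalChart hp m) v ξ : E × F).2) := by
  have h1 := ((verticalChart hp m).mdifferentiableAt_of_mem (x := bundleScale a v)
    hv).hasMFDerivAt.comp v (mdifferentiable_bundleScale a v).hasMFDerivAt
  let D : E × F →L[ℝ] E × F := (ContinuousLinearMap.fst ℝ E F).prod
    (a • ContinuousLinearMap.snd ℝ E F)
  have h2 := D.hasMFDerivAt.comp v
    ((verticalChart hp m).mdifferentiableAt_of_mem (x := v) hv).hasMFDerivAt
  have h3 : (verticalChart hp m ∘ bundleScale a : TotalSpace F (Vertical hp) → E × F) =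
      D ∘ verticalChart hp m := funext fun w ↦ verticalChart_bundleScale hp m a w
  rw [h3] at h1
  exact DFunLike.congr_fun (hasMFDerivAt_unique h1 h2) ξ

end VerticalChart

/-- Smooth paracompactness is stated for a set of open sets; here it is put in the form needed
later, with a point `c i` chosen for each member `i` of the cover such that `A (c i) = i`. -/
theorem SmoothlyParacompact.exists_partition {E M : Type*} [NormedAddCommGroup E]
    [NormedSpace ℝ E] [TopologicalSpace M] [ChartedSpace E M] (hM : SmoothlyParacompact E M)
    {A : M → Set M} (hA : ∀ m, IsOpen (A m)) (hmem : ∀ m, m ∈ A m) :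
    ∃ (f : SmoothPartitionOfUnity (range A) 𝓘(ℝ, E) M univ) (c : range A → M),
      ∀ i, tsupport (f i) ⊆ A (c i) := by
  obtain ⟨f, hf⟩ := hM.2 (range A) (by rintro _ ⟨m, rfl⟩; exact hA m)
    (eq_univ_of_forall fun m ↦ ⟨A m, mem_range_self m, hmem m⟩)
  choose c hc using fun i : range A ↦ i.2
  exact ⟨f, c, fun i ↦ by rw [hc]; exact hf i⟩

/-! ### Existence of sprays by partitions of unity -/

section Existence

variable {E E' F : Type*} [NormedAddCommGroup E] [NormedSpace ℝ E]
  [NormedAddCommGroup E'] [NormedSpace ℝ E'] [NormedAddCommGroup F] [NormedSpace ℝ F]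
  {M N : Type*} [TopologicalSpace M] [ChartedSpace E M] [IsManifold 𝓘(ℝ, E) ∞ M]
  [TopologicalSpace N] [ChartedSpace E' N] [IsManifold 𝓘(ℝ, E') ∞ N]
  {p : M → N} (hp : IsSubmersionOfComplement F 𝓘(ℝ, E) 𝓘(ℝ, E') ∞ p)

/-- The flat spray in the chart of the vertical bundle around `m`. -/
def flatSpray (m : M) (v : TotalSpace F (Vertical hp)) :
    TangentSpace (𝓘(ℝ, E).prod 𝓘(ℝ, F)) v :=
  (mfderiv 𝓘(ℝ, E × F) (𝓘(ℝ, E).prod 𝓘(ℝ, F)) (verticalChart hp m).symm (verticalChart hp m v)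
    (((hp m).equiv.symm (0, (verticalChart hp m v).2), 0) : E × F) : E × F)

theorem mfderiv_verticalChart_flatSpray (m : M) {v : TotalSpace F (Vertical hp)}
    (hv : v.proj ∈ (hp m).domChart.source) :
    (mfderiv (𝓘(ℝ, E).prod 𝓘(ℝ, F)) 𝓘(ℝ, E × F) (verticalChart hp m) v (flatSpray hp m v) :
      E × F) = ((hp m).equiv.symm (0, (verticalChart hp m v).2), 0) :=
  (verticalChart hp m).mfderiv_mfderiv_symm_apply (x := v) hv _

theorem contMDiffOn_flatSpray (m : M) :
    ContMDiffOn (𝓘(ℝ, E).prod 𝓘(ℝ, F)) (𝓘(ℝ, E).prod 𝓘(ℝ, F)).tangent ∞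
      (fun v ↦ (⟨v, flatSpray hp m v⟩ :
        TangentBundle (𝓘(ℝ, E).prod 𝓘(ℝ, F)) (TotalSpace F (Vertical hp))))
      (verticalChart hp m).source := by
  have h : ContDiff ℝ ∞ fun z : E × F ↦ (((hp m).equiv.symm (0, z.2), 0) : E × F) := by fun_prop
  exact (verticalChart hp m).contMDiffOn_mfderiv_symm h.contDiffOn

theorem mfderiv_proj_flatSpray (m : M) {v : TotalSpace F (Vertical hp)}
    (hv : v.proj ∈ (hp m).domChart.source) :
    mfderiv (𝓘(ℝ, E).prod 𝓘(ℝ, F)) 𝓘(ℝ, E) (π F (Vertical hp)) v (flatSpray hp m v) =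
      verticalIncl hp v.proj v.2 := by
  apply (mdifferentiable_domChart hp m).mfderiv_injective hv
  have h1 := fst_mfderiv_verticalChart hp m hv (flatSpray hp m v)
  rw [mfderiv_verticalChart_flatSpray hp m hv] at h1
  exact h1.symm.trans (mfderiv_domChart_verticalIncl hp m hv).symm

/-- In the chart the field is `(y, w) ↦ ((0, w), 0)`: its first component is linear in `w`, and the
second, which must scale by `a²`, vanishes. -/
theorem flatSpray_bundleScale (m : M) (a : ℝ) {v : TotalSpace F (Vertical hp)}
    (hv : v.proj ∈ (hp m).domChart.source) :
    flatSpray hp m (bundleScale a v) =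
      mfderiv (𝓘(ℝ, E).prod 𝓘(ℝ, F)) (𝓘(ℝ, E).prod 𝓘(ℝ, F)) (bundleScale a) v
        (a • flatSpray hp m v) := by
  apply (verticalChart hp m).mfderiv_injective (x := bundleScale a v) hv
  refine (mfderiv_verticalChart_flatSpray hp m (v := bundleScale a v) hv).trans ?_
  refine Eq.trans ?_ (mfderiv_verticalChart_bundleScale hp m a hv (a • flatSpray hp m v)).symm
  rw [map_smul, mfderiv_verticalChart_flatSpray hp m hv, verticalChart_bundleScale]
  have h : ((0, a • (verticalChart hp m v).2) : E' × F) = a • (0, (verticalChart hp m v).2) := by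
    simp
  refine Prod.ext ?_ ?_
  · change (hp m).equiv.symm (0, a • (verticalChart hp m v).2) =
      a • (hp m).equiv.symm (0, (verticalChart hp m v).2)
    rw [h, map_smul]
  · change (0 : F) = a • a • 0
    simp

/-- On a smoothly paracompact manifold, the vertical bundle of a submersion carries a spray. -/
theorem exists_isSpray (hM : SmoothlyParacompact E M) :
    ∃ S : ∀ v : TotalSpace F (Vertical hp), TangentSpace (𝓘(ℝ, E).prod 𝓘(ℝ, F)) v,
      IsSpray (verticalIncl hp) S := by
  obtain ⟨f, c, hfc⟩ := hM.exists_partition (A := fun m ↦ (hp m).domChart.source)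
    (fun m ↦ (hp m).domChart.open_source) fun m ↦ (hp m).mem_domChart_source
  have hproj : ContMDiff (𝓘(ℝ, E).prod 𝓘(ℝ, F)) 𝓘(ℝ, E) ∞ (π F (Vertical hp)) :=
    contMDiff_proj (Vertical hp)
  have hfin : ∀ m : M, (support fun i ↦ f i m).Finite := fun m ↦ f.locallyFinite.point_finite m
  have hsrc : ∀ (i) (v : TotalSpace F (Vertical hp)), f i v.proj ≠ 0 →
      v.proj ∈ (hp (c i)).domChart.source := fun i v h ↦ hfc i (subset_tsupport _ h)
  have hsupp : ∀ (v v' : TotalSpace F (Vertical hp)),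
      (support fun i ↦ f i v.proj • flatSpray hp (c i) v').Finite := fun v v' ↦
    (hfin v.proj).subset fun i hi h ↦ hi (by simp [h])
  -- The anchor condition is affine and the weights sum to `1`. Homogeneity is linear, and the
  -- weights depend only on the base point, which scaling preserves. Outside its chart domain a flat
  -- spray has meaningless values, but there its weight is `0`.
  refine ⟨fun v ↦ ∑ᶠ i, f i v.proj • flatSpray hp (c i) v, ?_, fun v ↦ ?_, fun a v ↦ ?_⟩
  · refine ContMDiff.finsum_section_of_locallyFinite
      (t := fun i v ↦ f i v.proj • flatSpray hp (c i) v) ?_ fun i ↦ ?_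
    · refine (f.locallyFinite.preimage_continuous hproj.continuous).subset fun i v hv ↦ ?_
      exact left_ne_zero_of_smul hv
    · refine ContMDiffOn.smul_section_of_tsupport (ψ := fun v ↦ f i v.proj)
        (u := (verticalChart hp (c i)).source) ?_ (verticalChart hp (c i)).open_source ?_
        (contMDiffOn_flatSpray hp (c i))
      · exact ((f i).contMDiff.comp hproj).contMDiffOn
      · refine (tsupport_comp_subset_preimage (f i) hproj.continuous).trans fun v hv ↦ hfc i hv
  · have h1 := (mfderiv (𝓘(ℝ, E).prod 𝓘(ℝ, F)) 𝓘(ℝ, E)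
      (π F (Vertical hp)) v).toLinearMap.toAddMonoidHom.map_finsum (hsupp v v)
    refine h1.trans ?_
    have h2 : ∀ i, mfderiv (𝓘(ℝ, E).prod 𝓘(ℝ, F)) 𝓘(ℝ, E) (π F (Vertical hp)) v
        (f i v.proj • flatSpray hp (c i) v) = f i v.proj • verticalIncl hp v.proj v.2 := by
      intro i
      by_cases h : f i v.proj = 0
      · simp [h]
      · rw [map_smul, mfderiv_proj_flatSpray hp (c i) (hsrc i v h)]
    refine (finsum_congr h2).trans ?_
    rw [← finsum_smul, f.sum_eq_one (mem_univ _), one_smul]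
  · rw [smul_finsum]
    have h1 := (mfderiv (𝓘(ℝ, E).prod 𝓘(ℝ, F)) (𝓘(ℝ, E).prod 𝓘(ℝ, F)) (bundleScale a)
      v).toLinearMap.toAddMonoidHom.map_finsum (f := fun i ↦
        a • f i v.proj • flatSpray hp (c i) v) ((hfin v.proj).subset fun i hi h ↦ hi (by simp [h]))
    refine Eq.trans (finsum_congr fun i ↦ ?_) h1.symm
    change f i v.proj • flatSpray hp (c i) (bundleScale a v) =
      mfderiv (𝓘(ℝ, E).prod 𝓘(ℝ, F)) (𝓘(ℝ, E).prod 𝓘(ℝ, F)) (bundleScale a) v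
        (a • f i v.proj • flatSpray hp (c i) v)
    by_cases h : f i v.proj = 0
    · simp [h]
    · rw [smul_comm, map_smul, flatSpray_bundleScale hp (c i) a (hsrc i v h)]

end Existence

/-! ### Local form and flow of a vertical spray -/

section Exponential

variable {E E' F : Type*} [NormedAddCommGroup E] [NormedSpace ℝ E]
  [NormedAddCommGroup E'] [NormedSpace ℝ E'] [NormedAddCommGroup F] [NormedSpace ℝ F]
  {M N : Type*} [TopologicalSpace M] [ChartedSpace E M] [IsManifold 𝓘(ℝ, E) ∞ M]
  [TopologicalSpace N] [ChartedSpace E' N] [IsManifold 𝓘(ℝ, E') ∞ N]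
  {p : M → N} (hp : IsSubmersionOfComplement F 𝓘(ℝ, E) 𝓘(ℝ, E') ∞ p)

theorem completeSpace_complement (hp : IsSubmersionOfComplement F 𝓘(ℝ, E) 𝓘(ℝ, E') ∞ p)
    [CompleteSpace E] (m : M) : CompleteSpace F := by
  have h1 : CompleteSpace (E' × F) :=
    (completeSpace_congr (e := (hp m).equiv.toEquiv) (hp m).equiv.isUniformEmbedding).1 ‹_›
  exact (completeSpace_prod_of_nonempty.1 h1).2

/-- Vectors over distinct points are separated in `M`, vectors over one point in a common chart. The
Hausdorff property is what makes integral curves unique. -/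
theorem t2Space_vertical [T2Space M] : T2Space (TotalSpace F (Vertical hp)) := by
  refine ⟨fun v w hvw ↦ ?_⟩
  have hc : Continuous (π F (Vertical hp)) := FiberBundle.continuous_proj F (Vertical hp)
  by_cases h : v.proj = w.proj
  · let Φ := (verticalChart hp v.proj).toOpenPartialHomeomorph
    have hv : v ∈ Φ.source := (hp v.proj).mem_domChart_source
    have hw : w ∈ Φ.source := (mem_verticalChart_source hp).2
      (h ▸ (hp v.proj).mem_domChart_source)
    obtain ⟨s, t, hs, ht, hvs, hwt, hst⟩ := t2_separation (Φ.injOn.ne hv hw hvw)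
    refine ⟨Φ.source ∩ Φ ⁻¹' s, Φ.source ∩ Φ ⁻¹' t, Φ.isOpen_inter_preimage hs,
      Φ.isOpen_inter_preimage ht, ⟨hv, hvs⟩, ⟨hw, hwt⟩, ?_⟩
    exact (hst.preimage Φ).mono inter_subset_right inter_subset_right
  · obtain ⟨s, t, hs, ht, hvs, hwt, hst⟩ := t2_separation h
    exact ⟨_, _, hs.preimage hc, ht.preimage hc, hvs, hwt, hst.preimage _⟩

variable {hp} {S : ∀ v : TotalSpace F (Vertical hp), TangentSpace (𝓘(ℝ, E).prod 𝓘(ℝ, F)) v}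

/-- Two integral curves with the same initial value agree on the intersection of their intervals,
which contains `0` and `1`. Hence the choice made in `sprayExp` does not matter. -/
theorem IsSpray.isTimeOneFlow_unique [T2Space M] (hS : IsSpray (verticalIncl hp) S)
    {v w w' : TotalSpace F (Vertical hp)} (h : IsTimeOneFlow S v w) (h' : IsTimeOneFlow S v w') :
    w = w' := by
  have := t2Space_vertical hp
  obtain ⟨γ, a, b, ha, hb, hγ, h0, h1⟩ := h
  obtain ⟨γ', a', b', ha', hb', hγ', h0', h1'⟩ := h'
  have hsub : Ioo (max a a') (min b b') ⊆ Ioo a b :=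
    Ioo_subset_Ioo (le_max_left _ _) (min_le_left _ _)
  have hsub' : Ioo (max a a') (min b b') ⊆ Ioo a' b' :=
    Ioo_subset_Ioo (le_max_right _ _) (min_le_right _ _)
  have h01 : (0 : ℝ) < min b b' := lt_min (by linarith) (by linarith)
  have key := isMIntegralCurveOn_Ioo_eqOn_of_contMDiff_boundaryless (t₀ := 0)
    ⟨max_lt ha ha', h01⟩ (hS.contMDiff.of_le (by simp)) (hγ.mono hsub) (hγ'.mono hsub')
    (h0.trans h0'.symm)
  rw [← h1, ← h1']
  exact key ⟨(max_lt ha ha').trans zero_lt_one, lt_min hb hb'⟩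

theorem IsSpray.sprayExp_eq [T2Space M] (hS : IsSpray (verticalIncl hp) S)
    {v w : TotalSpace F (Vertical hp)} (h : IsTimeOneFlow S v w) : sprayExp S v = w.proj := by
  have h' : ∃ w, IsTimeOneFlow S v w := ⟨w, h⟩
  rw [sprayExp, dif_pos h', hS.isTimeOneFlow_unique h'.choose_spec h]

/-- In a chart, a spray has the form `(y, w) ↦ ((0, w), Γ (y, w))`. -/
theorem IsSpray.fst_principalPart (hS : IsSpray (verticalIncl hp) S) (m : M) {z : E × F}
    (hz : z.1 ∈ (hp m).domChart.target) :
    ((verticalChart hp m).principalPart S z).1 = (hp m).equiv.symm (0, z.2) := by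
  have hz' : z ∈ (verticalChart hp m).target := (mem_verticalChart_target hp).2 hz
  have hs : ((verticalChart hp m).symm z).proj ∈ (hp m).domChart.source :=
    (verticalChart hp m).map_target hz'
  have hr : verticalChart hp m ((verticalChart hp m).symm z) = z :=
    (verticalChart hp m).right_inv hz'
  have h1 := fst_mfderiv_verticalChart hp m hs (S ((verticalChart hp m).symm z))
  rw [hS.lifts_anchor] at h1
  refine h1.trans ((mfderiv_domChart_verticalIncl hp m hs).trans ?_)
  rw [hr]

theorem IsSpray.principalPart_smul (hS : IsSpray (verticalIncl hp) S) (m : M) (a : ℝ) {z : E × F}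
    (hz : z.1 ∈ (hp m).domChart.target) :
    (verticalChart hp m).principalPart S (z.1, a • z.2) =
      (a • ((verticalChart hp m).principalPart S z).1,
        a • a • ((verticalChart hp m).principalPart S z).2) := by
  have hz' : z ∈ (verticalChart hp m).target := (mem_verticalChart_target hp).2 hz
  have hs : ((verticalChart hp m).symm z).proj ∈ (hp m).domChart.source :=
    (verticalChart hp m).map_target hz'
  have h1 := mfderiv_verticalChart_bundleScale hp m a hs (a • S ((verticalChart hp m).symm z))
  rw [← hS.homogeneous, map_smul] at h1
  refine Eq.trans ?_ h1
  rw [PartialDiffeomorph.principalPart, bundleScale_verticalChart_symm hp m a hz]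

/-- The linearisation of a spray at a zero vector, in a chart. -/
def sprayLinearization (hp : IsSubmersionOfComplement F 𝓘(ℝ, E) 𝓘(ℝ, E') ∞ p) (m : M) :
    E × F →L[ℝ] E × F :=
  (ContinuousLinearMap.inl ℝ E F).comp ((((hp m).equiv.symm : E' × F →L[ℝ] E).comp
    (ContinuousLinearMap.inr ℝ E' F)).comp (ContinuousLinearMap.snd ℝ E F))

theorem sprayLinearization_apply (m : M) (z : E × F) :
    sprayLinearization hp m z = ((hp m).equiv.symm (0, z.2), 0) := rfl

/-- The first component is already linear. The second vanishes on the zero section, so its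
derivative along `E` is zero, and it is quadratic on fibres, so its derivative along `F` is zero. -/
theorem IsSpray.hasFDerivAt_principalPart (hS : IsSpray (verticalIncl hp) S) (m : M) {y : E}
    (hy : y ∈ (hp m).domChart.target) :
    HasFDerivAt ((verticalChart hp m).principalPart S) (sprayLinearization hp m) (y, 0) := by
  set g := (verticalChart hp m).principalPart S with hg
  have hmem : ((y, 0) : E × F) ∈ (verticalChart hp m).target :=
    (mem_verticalChart_target hp).2 hy
  have hnhds := (verticalChart hp m).open_target.mem_nhds hmem
  have hD : HasFDerivAt g (fderiv ℝ g (y, 0)) (y, 0) :=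
    (((verticalChart hp m).contDiffOn_principalPart hS.contMDiff).contDiffAt
      hnhds).differentiableAt (by simp) |>.hasFDerivAt
  refine hD.congr_fderiv ?_
  set D := fderiv ℝ g (y, 0)
  have hfst : ∀ z, (D z).1 = (hp m).equiv.symm (0, z.2) := by
    have h1 : HasFDerivAt (fun z ↦ (g z).1) ((ContinuousLinearMap.fst ℝ E F).comp D) (y, 0) :=
      (ContinuousLinearMap.fst ℝ E F).hasFDerivAt.comp (y, 0) hD
    have h2 : HasFDerivAt (fun z ↦ (sprayLinearization hp m z).1)
        ((ContinuousLinearMap.fst ℝ E F).comp (sprayLinearization hp m)) ((y, 0) : E × F) :=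
      ((ContinuousLinearMap.fst ℝ E F).comp (sprayLinearization hp m)).hasFDerivAt
    have h3 : (fun z ↦ (g z).1) =ᶠ[𝓝 (y, 0)] fun z ↦ (sprayLinearization hp m z).1 := by
      filter_upwards [hnhds] with z hz
      exact hS.fst_principalPart m ((mem_verticalChart_target hp).1 hz)
    exact fun z ↦ DFunLike.congr_fun (h1.unique (h2.congr_of_eventuallyEq h3)) z
  have hsnd : HasFDerivAt (fun z ↦ (g z).2) ((ContinuousLinearMap.snd ℝ E F).comp D) (y, 0) :=
    (ContinuousLinearMap.snd ℝ E F).hasFDerivAt.comp (y, 0) hD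
  have hbase : ∀ u : E, (D (u, 0)).2 = 0 := by
    have h1 : HasFDerivAt (fun x ↦ (g (x, 0)).2)
        (((ContinuousLinearMap.snd ℝ E F).comp D).comp (ContinuousLinearMap.inl ℝ E F)) y :=
      HasFDerivAt.comp (f := fun x : E ↦ ((x, 0) : E × F)) y hsnd
        (ContinuousLinearMap.inl ℝ E F).hasFDerivAt
    have h2 : (fun x ↦ (g (x, 0)).2) =ᶠ[𝓝 y] fun _ ↦ 0 := by
      filter_upwards [(hp m).domChart.open_target.mem_nhds hy] with x hx
      have h3 := hS.principalPart_smul m 0 (z := (x, 0)) hx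
      simp only [smul_zero, zero_smul] at h3
      rw [hg, h3]
    exact fun u ↦ DFunLike.congr_fun
      (h1.unique ((hasFDerivAt_const (0 : F) y).congr_of_eventuallyEq h2)) u
  have hfib : ∀ w : F, (D (0, w)).2 = 0 := by
    intro w
    have h0 : HasDerivAt (fun t : ℝ ↦ ((y, t • w) : E × F)) (0, w) 0 := by
      have := (hasDerivAt_id (0 : ℝ)).smul_const w
      rw [one_smul] at this
      exact (hasDerivAt_const (0 : ℝ) y).prodMk this
    have h1 : HasDerivAt (fun t : ℝ ↦ (g (y, t • w)).2) (D (0, w)).2 0 :=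
      HasFDerivAt.comp_hasDerivAt (l := fun z ↦ (g z).2)
        (l' := (ContinuousLinearMap.snd ℝ E F).comp D)
        (f := fun t : ℝ ↦ ((y, t • w) : E × F)) (0 : ℝ) (by simpa using hsnd) h0
    have h2 : (fun t : ℝ ↦ (g (y, t • w)).2) = fun t ↦ (t * t) • (g (y, w)).2 := by
      funext t
      rw [hg, hS.principalPart_smul m t (z := (y, w)) hy, smul_smul]
    rw [h2] at h1
    have h3 := ((hasDerivAt_id (0 : ℝ)).mul (hasDerivAt_id (0 : ℝ))).smul_const (g (y, w)).2
    simpa using h1.unique h3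
  refine ContinuousLinearMap.ext fun z ↦ Prod.ext (hfst z) ?_
  have h : z = (z.1, 0) + (0, z.2) := by simp
  rw [h, map_add, Prod.snd_add, hbase, hfib, add_zero]
  rfl

/-- The flow of a spray near a zero vector: in the chart around `m`, it is given by curves `c z`
which depend smoothly on the initial value `z` and remain over one fibre of `p`. -/
theorem IsSpray.exists_flow [CompleteSpace E] (hS : IsSpray (verticalIncl hp) S) (m : M) :
    ∃ (O : Set (E × F)) (c : E × F → E × F), IsOpen O ∧ ((hp m).domChart m, 0) ∈ O ∧
      O ⊆ (verticalChart hp m).target ∧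
      (∀ z ∈ O, c z ∈ (verticalChart hp m).target ∧
        IsTimeOneFlow S ((verticalChart hp m).symm z) ((verticalChart hp m).symm (c z)) ∧
        ((hp m).equiv (c z).1).1 = ((hp m).equiv z.1).1) ∧
      ContDiffOn ℝ ∞ c O ∧
      HasFDerivAt c (ContinuousLinearMap.id ℝ (E × F) + sprayLinearization hp m)
        ((hp m).domChart m, 0) := by
  have := completeSpace_complement hp m
  have hm : (hp m).domChart m ∈ (hp m).domChart.target :=
    (hp m).domChart.map_source (hp m).mem_domChart_source
  set g := (verticalChart hp m).principalPart S with hg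
  have hg0 : g ((hp m).domChart m, 0) = 0 := by
    have h := hS.principalPart_smul m 0 (z := ((hp m).domChart m, 0)) hm
    simp only [smul_zero, zero_smul] at h
    exact h
  obtain ⟨O, c, hO, hmO, hc0, hc, hcs, hcd⟩ := exists_flow_of_sq_fderiv_eq_zero
    (verticalChart hp m).open_target ((verticalChart hp m).contDiffOn_principalPart hS.contMDiff)
    ((mem_verticalChart_target hp).2 hm) hg0 (hS.hasFDerivAt_principalPart m hm)
    -- The linearisation depends only on the `F`-component and takes values in `E × 0`, so its
    -- square is zero.
    (fun v ↦ by simp [sprayLinearization_apply])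
  refine ⟨O, fun z ↦ c z 1, hO, hmO, fun z hz ↦ ?_, fun z hz ↦ ⟨?_, ?_, ?_⟩, hcs, hcd⟩
  · have := (hc z hz 0 (by norm_num)).1
    rwa [hc0 z hz] at this
  · exact (hc z hz 1 (by norm_num)).1
  · refine ⟨fun t ↦ (verticalChart hp m).symm (c z t), -1, 2, by norm_num, by norm_num, ?_,
      by beta_reduce; rw [hc0 z hz], rfl⟩
    intro t ht
    obtain ⟨h1, h2⟩ := hc z hz t ht
    have h3 := ((verticalChart hp m).mdifferentiableAt_symm h1).hasMFDerivAt.comp t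
      h2.hasFDerivAt.hasMFDerivAt
    refine (h3.congr_mfderiv ?_).hasMFDerivWithinAt
    ext
    have h4 : mfderiv 𝓘(ℝ, E × F) (𝓘(ℝ, E).prod 𝓘(ℝ, F)) (verticalChart hp m).symm (c z t)
        (g (c z t)) = S ((verticalChart hp m).symm (c z t)) :=
      (verticalChart hp m).symm.mfderiv_mfderiv_symm_apply (x := c z t) h1
        (S ((verticalChart hp m).symm (c z t)))
    change mfderiv 𝓘(ℝ, E × F) (𝓘(ℝ, E).prod 𝓘(ℝ, F)) (verticalChart hp m).symm (c z t)
      ((1 : ℝ) • g (c z t)) = (1 : ℝ) • S ((verticalChart hp m).symm (c z t))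
    rw [one_smul, one_smul]
    exact h4
  -- The velocity of the base point is `(0, w)` in `E' × F`, so the `E'`-coordinate is constant
  -- along the flow, which therefore stays over one fibre of `p`.
  · let L : E × F →L[ℝ] E' := (ContinuousLinearMap.fst ℝ E' F).comp
      (((hp m).equiv : E →L[ℝ] E' × F).comp (ContinuousLinearMap.fst ℝ E F))
    have h1 : ∀ t ∈ Ioo (-1 : ℝ) 2, HasDerivAt (fun t ↦ L (c z t)) 0 t := by
      intro t ht
      obtain ⟨h1, h2⟩ := hc z hz t ht
      have h3 := L.hasFDerivAt.comp_hasDerivAt t h2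
      have h4 : L (g (c z t)) = 0 := by
        change ((hp m).equiv (g (c z t)).1).1 = 0
        rw [hg, hS.fst_principalPart m ((mem_verticalChart_target hp).1 h1)]
        simp
      rwa [h4] at h3
    have h2 := isOpen_Ioo.is_const_of_deriv_eq_zero isPreconnected_Ioo
      (fun t ht ↦ (h1 t ht).differentiableAt.differentiableWithinAt)
      (fun t ht ↦ (h1 t ht).deriv) (x := 1) (y := 0) (by norm_num) (by norm_num)
    rw [hc0 z hz] at h2
    exact h2

end Exponential

/-! ### Charts and open inclusions as local diffeomorphisms -/

section LocalDiffeo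

variable {B : Type*} [NormedAddCommGroup B] [NormedSpace ℝ B] {H : Type*} [TopologicalSpace H]
  {I : ModelWithCorners ℝ B H} {X : Type*} [TopologicalSpace X] [ChartedSpace H X]

/-- The preferred chart of a manifold without boundary modelled on `B` as a partial
diffeomorphism. -/
def chartDiffeomorph {Y : Type*} [TopologicalSpace Y] [ChartedSpace B Y]
    [IsManifold 𝓘(ℝ, B) ∞ Y] (y : Y) : PartialDiffeomorph 𝓘(ℝ, B) 𝓘(ℝ, B) Y B ∞ where
  toPartialEquiv := (chartAt B y).toPartialEquiv
  open_source := (chartAt B y).open_source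
  open_target := (chartAt B y).open_target
  contMDiffOn_toFun := contMDiffOn_chart
  contMDiffOn_invFun := contMDiffOn_chart_symm

theorem isLocalDiffeomorph_subtypeVal (U : TopologicalSpace.Opens X) :
    IsLocalDiffeomorph I I ∞ (Subtype.val : U → X) := by
  intro x
  have hne : Nonempty U := ⟨x⟩
  let e := U.openPartialHomeomorphSubtypeCoe hne
  have he : ∀ y ∈ (U : Set X), ((e.symm y : U) : X) = y := fun y hy ↦
    e.right_inv (by simpa [e] using hy)
  refine ⟨⟨e.toPartialEquiv, e.open_source, e.open_target, contMDiff_subtype_val.contMDiffOn,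
    fun y hy ↦ ?_⟩, mem_univ _, fun _ _ ↦ rfl⟩
  have hyU : y ∈ (U : Set X) := by simpa [e] using hy
  refine (ContMDiffWithinAt.subtypeVal_comp_iff U e.symm e.target y).1 ?_
  refine contMDiffWithinAt_id.congr (fun z hz ↦ he z (by simpa [e] using hz)) (he y hyU)

end LocalDiffeo

/-! ### The exponential map as a local addition -/

section LocalAddition

variable {E E' F : Type*} [NormedAddCommGroup E] [NormedSpace ℝ E]
  [NormedAddCommGroup E'] [NormedSpace ℝ E'] [NormedAddCommGroup F] [NormedSpace ℝ F]
  {M N : Type*} [TopologicalSpace M] [ChartedSpace E M] [IsManifold 𝓘(ℝ, E) ∞ M]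
  [TopologicalSpace N] [ChartedSpace E' N] [IsManifold 𝓘(ℝ, E') ∞ N]
  {p : M → N} {hp : IsSubmersionOfComplement F 𝓘(ℝ, E) 𝓘(ℝ, E') ∞ p}

variable (hp) in
/-- A pair of points in the same fibre, as a point of the fibre product. -/
def FibreProduct.mk (m m' : M) (h : p m = p m') : FibreProduct hp := ⟨(m, m'), h⟩

open Classical in
/-- The map `(π, exp)` into the fibre product (with an irrelevant value where `exp v` does not lie
in the fibre of the base point of `v`). -/
def expPair (S : ∀ v : TotalSpace F (Vertical hp), TangentSpace (𝓘(ℝ, E).prod 𝓘(ℝ, F)) v)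
    (v : TotalSpace F (Vertical hp)) : FibreProduct hp :=
  if h : p v.proj = p (sprayExp S v) then .mk hp v.proj (sprayExp S v) h
  else .mk hp v.proj v.proj rfl

variable {S : ∀ v : TotalSpace F (Vertical hp), TangentSpace (𝓘(ℝ, E).prod 𝓘(ℝ, F)) v}

theorem fst_expPair (v : TotalSpace F (Vertical hp)) : (expPair S v).fst = v.proj := by
  rw [expPair]
  split_ifs <;> rfl

theorem snd_expPair {v : TotalSpace F (Vertical hp)} (h : p v.proj = p (sprayExp S v)) :
    (expPair S v).snd = sprayExp S v := by
  rw [expPair, dif_pos h]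
  rfl

variable (hp) in
/-- The derivative of `(π, exp)` at a zero vector, in charts. -/
def expPairDeriv (m : M) : (E × F) ≃L[ℝ] E × F :=
  let L : E × F →L[ℝ] F := (ContinuousLinearMap.snd ℝ E' F).comp
    (((hp m).equiv : E →L[ℝ] E' × F).comp (ContinuousLinearMap.fst ℝ E F))
  ContinuousLinearEquiv.equivOfInverse
    ((ContinuousLinearMap.fst ℝ E F).prod (L + ContinuousLinearMap.snd ℝ E F))
    ((ContinuousLinearMap.fst ℝ E F).prod (ContinuousLinearMap.snd ℝ E F - L))
    (fun z ↦ Prod.ext rfl (by simp [L])) (fun z ↦ Prod.ext rfl (by simp [L]))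

/-- Homogeneity with factor `0` forces `S` to vanish at zero vectors, so the constant curve is
integral. -/
theorem IsSpray.isTimeOneFlow_zeroSection (hS : IsSpray (verticalIncl hp) S) (m : M) :
    IsTimeOneFlow S (zeroSection F (Vertical hp) m) (zeroSection F (Vertical hp) m) := by
  have h0 : S (zeroSection F (Vertical hp) m) = 0 := by
    have h := hS.homogeneous 0 (zeroSection F (Vertical hp) m)
    rw [zero_smul, map_zero] at h
    have h' : bundleScale 0 (zeroSection F (Vertical hp) m) = zeroSection F (Vertical hp) m := by
      change (⟨m, (0 : ℝ) • (0 : Vertical hp m)⟩ : TotalSpace F (Vertical hp)) = ⟨m, 0⟩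
      rw [smul_zero]
    rwa [h'] at h
  refine ⟨fun _ ↦ zeroSection F (Vertical hp) m, -1, 2, by norm_num, by norm_num, fun t _ ↦ ?_,
    rfl, rfl⟩
  refine ((hasMFDerivAt_const (zeroSection F (Vertical hp) m) t).congr_mfderiv
    ?_).hasMFDerivWithinAt
  beta_reduce
  rw [h0]
  ext
  simp
  rfl

/-- Near a zero vector, `(π, exp)` is a diffeomorphism onto an open subset of the fibre product. -/
theorem IsSpray.exists_partialDiffeomorph [CompleteSpace E] [T2Space M]
    (hS : IsSpray (verticalIncl hp) S) (m : M) :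
    ∃ Θ : PartialDiffeomorph (𝓘(ℝ, E).prod 𝓘(ℝ, F)) 𝓘(ℝ, E × F) (TotalSpace F (Vertical hp))
        (FibreProduct hp) ∞,
      zeroSection F (Vertical hp) m ∈ Θ.source ∧ EqOn (expPair S) Θ Θ.source ∧
      ∀ v ∈ Θ.source, v ∈ expDomain S ∧ p v.proj = p (sprayExp S v) := by
  have := completeSpace_complement hp m
  obtain ⟨O, c, hO, hmO, hOt, hc, hcs, hcd⟩ := hS.exists_flow m
  let Φ := verticalChart hp m
  let χ : PartialDiffeomorph 𝓘(ℝ, E × F) 𝓘(ℝ, E × F) (FibreProduct hp) (E × F) ∞ :=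
    chartDiffeomorph (FibreProduct.mk hp m m rfl)
  have hexp : ∀ v ∈ Φ.source, Φ v ∈ O → v ∈ expDomain S ∧
      sprayExp S v ∈ (hp m).domChart.source ∧ (hp m).domChart (sprayExp S v) = (c (Φ v)).1 ∧
      p v.proj = p (sprayExp S v) := by
    intro v hv hvO
    obtain ⟨h1, h2, h3⟩ := hc _ hvO
    have hleft : Φ.symm (Φ v) = v := Φ.left_inv hv
    have h1' := (mem_verticalChart_target hp).1 h1
    rw [show (verticalChart hp m).symm (Φ v) = v from hleft] at h2
    have h4 : sprayExp S v = (hp m).domChart.symm (c (Φ v)).1 := by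
      rw [hS.sprayExp_eq h2, proj_verticalChart_symm hp m h1']
    have h5 : sprayExp S v ∈ (hp m).domChart.source := by
      rw [h4]
      exact (hp m).domChart.map_target h1'
    have h6 : (hp m).domChart (sprayExp S v) = (c (Φ v)).1 := by
      rw [h4]
      exact (hp m).domChart.right_inv h1'
    refine ⟨⟨_, h2⟩, h5, h6, ?_⟩
    -- The two points have the same `E'`-coordinate, and the chart of `N` is injective, so they lie
    -- in the same fibre.
    refine (hp m).codChart.injOn ((hp m).source_subset_preimage_source hv)
      ((hp m).source_subset_preimage_source h5) ?_
    rw [← submersion_chart_eq (hp m) h5, h6, h3, ← submersion_chart_eq (hp m) hv]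
    rfl
  -- The expression of `(π, exp)` in the vertical chart around `m` and the chart of the fibre
  -- product around `(m, m)`.
  let f : E × F → E × F := fun z ↦ (z.1, ((hp m).equiv (c z).1).2)
  have hχ : ∀ v ∈ Φ.source, Φ v ∈ O → expPair S v ∈ χ.source ∧ χ (expPair S v) = f (Φ v) := by
    intro v hv hvO
    obtain ⟨-, h1, h2, h3⟩ := hexp v hv hvO
    have h4 : expPair S v = .mk hp v.proj (sprayExp S v) h3 := dif_pos h3
    rw [h4]
    refine ⟨⟨hv, h1⟩, ?_⟩
    change ((hp m).domChart v.proj, ((hp m).equiv ((hp m).domChart (sprayExp S v))).2) = _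
    rw [h2]
    rfl
  have hf : ContDiffOn ℝ ∞ f O := by
    have h1 : ContDiff ℝ ∞ fun z : E × F ↦ ((hp m).equiv z.1).2 := by fun_prop
    exact contDiff_fst.contDiffOn.prodMk (h1.comp_contDiffOn hcs)
  have hf' : HasFDerivAt f (expPairDeriv hp m : E × F →L[ℝ] E × F) ((hp m).domChart m, 0) := by
    let L : E × F →L[ℝ] F := (ContinuousLinearMap.snd ℝ E' F).comp
      (((hp m).equiv : E →L[ℝ] E' × F).comp (ContinuousLinearMap.fst ℝ E F))
    have h1 : HasFDerivAt f _ _ := (ContinuousLinearMap.fst ℝ E F).hasFDerivAt.prodMk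
      (L.hasFDerivAt.comp _ hcd)
    refine h1.congr_fderiv (ContinuousLinearMap.ext fun z ↦ Prod.ext rfl ?_)
    -- The base component of the time-one derivative is `u + (0, w)`, which contributes `w` to the
    -- `F`-component.
    change ((hp m).equiv (z.1 + (hp m).equiv.symm (0, z.2))).2 = ((hp m).equiv z.1).2 + z.2
    simp
  obtain ⟨e, hme, heO, hef, hes⟩ := exists_openPartialHomeomorph_contDiffOn_symm hO hmO hf hf'
  let e' : PartialDiffeomorph 𝓘(ℝ, E × F) 𝓘(ℝ, E × F) (E × F) (E × F) ∞ :=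
    ⟨e.toPartialEquiv, e.open_source, e.open_target,
      (show ContDiffOn ℝ ∞ e e.source from hef ▸ hf.mono heO).contMDiffOn, hes.contMDiffOn⟩
  have he' : ∀ z, e' z = f z := fun z ↦ congrFun hef z
  let Θ := (Φ.trans e').trans χ.symm
  have hsrc : ∀ v ∈ Θ.source, v ∈ Φ.source ∧ Φ v ∈ O := fun v hv ↦ ⟨hv.1.1, heO hv.1.2⟩
  have hz : Φ (zeroSection F (Vertical hp) m) = ((hp m).domChart m, 0) := by
    refine Prod.ext rfl ?_
    change ((hp m).equiv (mfderiv 𝓘(ℝ, E) 𝓘(ℝ, E) (hp m).domChart m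
      (verticalIncl hp m 0) : E)).2 = 0
    rw [map_zero, map_zero]
    exact congrArg Prod.snd (map_zero (hp m).equiv)
  have hzΦ : zeroSection F (Vertical hp) m ∈ Φ.source := (hp m).mem_domChart_source
  refine ⟨Θ, ⟨⟨hzΦ, ?_⟩, ?_⟩, fun v hv ↦ ?_, fun v hv ↦ ?_⟩
  · change Φ (zeroSection F (Vertical hp) m) ∈ e.source
    rwa [hz]
  · change e' (Φ (zeroSection F (Vertical hp) m)) ∈ χ.target
    obtain ⟨h1, h2⟩ := hχ _ hzΦ (by rwa [hz])
    rw [he', ← h2]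
    exact χ.map_source h1
  · obtain ⟨h1, h2⟩ := hχ v (hsrc v hv).1 (hsrc v hv).2
    change expPair S v = χ.symm (e' (Φ v))
    rw [he', ← h2]
    exact (χ.left_inv h1).symm
  · obtain ⟨h1, -, -, h2⟩ := hexp v (hsrc v hv).1 (hsrc v hv).2
    exact ⟨h1, h2⟩

/-- The exponential map of a spray on the vertical bundle restricts to a local addition. -/
theorem IsSpray.exists_isLocalAddition [CompleteSpace E] [T2Space M]
    (hM : SmoothlyParacompact E M) (hS : IsSpray (verticalIncl hp) S) :
    ∃ (U : TopologicalSpace.Opens (TotalSpace F (Vertical hp))) (Ψ : U → FibreProduct hp),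
      IsLocalAddition hp U Ψ ∧
      ∀ u : U, (u : TotalSpace F (Vertical hp)) ∈ expDomain S ∧ (Ψ u).snd = sprayExp S u := by
  choose Θ hzero heq hgood using fun m ↦ hS.exists_partialDiffeomorph m
  have hzs : Continuous (zeroSection F (Vertical hp)) :=
    (contMDiff_zeroSection (n := ∞) (IB := 𝓘(ℝ, E)) ℝ (Vertical hp)).continuous
  have hc : Continuous (π F (Vertical hp)) := FiberBundle.continuous_proj F (Vertical hp)
  obtain ⟨f, c, hfc⟩ := hM.exists_partition
    (A := fun m ↦ zeroSection F (Vertical hp) ⁻¹' (Θ m).source)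
    (fun m ↦ (Θ m).open_source.preimage hzs) hzero
  -- For each `i`, vectors over `tsupport (f i)` outside the local domain `Θ (c i)` are removed.
  -- Local finiteness keeps the union of the removed closed sets closed.
  have hclosed : IsClosed (⋃ i, π F (Vertical hp) ⁻¹' tsupport (f i) ∩ (Θ (c i)).sourceᶜ) := by
    refine LocallyFinite.isClosed_iUnion ?_ fun i ↦
      ((isClosed_tsupport _).preimage hc).inter (Θ (c i)).open_source.isClosed_compl
    exact (f.locallyFinite.closure.preimage_continuous hc).subset fun i ↦ inter_subset_left
  let U : TopologicalSpace.Opens (TotalSpace F (Vertical hp)) := ⟨_, hclosed.isOpen_compl⟩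
  have hU : ∀ v ∈ U, ∀ i, v.proj ∈ tsupport (f i) → v ∈ (Θ (c i)).source := by
    intro v hv i hi
    by_contra h
    exact hv (mem_iUnion.2 ⟨i, hi, h⟩)
  have hex : ∀ m : M, ∃ i, m ∈ tsupport (f i) := by
    intro m
    obtain ⟨i, hi⟩ := f.exists_pos_of_mem (mem_univ m)
    exact ⟨i, subset_tsupport _ hi.ne'⟩
  -- No zero vector is removed, because `tsupport (f i)` lies in the set of points whose zero vector
  -- belongs to `(Θ (c i)).source`.
  have hzU : ∀ m, zeroSection F (Vertical hp) m ∈ U := by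
    intro m hm
    obtain ⟨i, hi, h⟩ := mem_iUnion.1 hm
    exact h (hfc i hi)
  have hld : IsLocalDiffeomorph (𝓘(ℝ, E).prod 𝓘(ℝ, F)) 𝓘(ℝ, E × F) ∞
      (expPair S ∘ (Subtype.val : U → TotalSpace F (Vertical hp))) := by
    intro u
    obtain ⟨i, hi⟩ := hex u.1.proj
    have h : IsLocalDiffeomorphAt (𝓘(ℝ, E).prod 𝓘(ℝ, F)) 𝓘(ℝ, E × F) ∞ (expPair S) u.1 :=
      ⟨Θ (c i), hU u u.2 i hi, heq (c i)⟩
    exact (isLocalDiffeomorph_subtypeVal U u).comp _ _ h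
  -- Equal images force equal base points. This base point lies in some `tsupport (f i)`, so both
  -- vectors lie in the source of the single injective map `Θ (c i)`.
  have hinj : Injective (expPair S ∘ (Subtype.val : U → TotalSpace F (Vertical hp))) := by
    intro u u' h
    have h' : expPair S u = expPair S u' := h
    have hproj : u.1.proj = u'.1.proj := by
      rw [← fst_expPair (S := S) u.1, ← fst_expPair (S := S) u'.1, h']
    obtain ⟨i, hi⟩ := hex u.1.proj
    have h1 := hU u u.2 i hi
    have h2 := hU u' u'.2 i (hproj ▸ hi)
    rw [heq _ h1, heq _ h2] at h'
    exact Subtype.ext ((Θ (c i)).injOn h1 h2 h')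
  have hmem : ∀ u : U, (u : TotalSpace F (Vertical hp)) ∈ expDomain S ∧
      p u.1.proj = p (sprayExp S u) := by
    intro u
    obtain ⟨i, hi⟩ := hex u.1.proj
    exact hgood _ u (hU u u.2 i hi)
  have hsnd : ∀ u : U, (expPair S u).snd = sprayExp S u := fun u ↦ snd_expPair (hmem u).2
  refine ⟨U, expPair S ∘ Subtype.val,
    ⟨hzU, .of_continuous_injective_isOpenMap hld.contMDiff.continuous hinj hld.isOpenMap, hld,
      fun m ↦ ⟨fst_expPair _, ?_⟩, fun u ↦ fst_expPair _⟩, fun u ↦ ⟨(hmem u).1, hsnd u⟩⟩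
  exact (hsnd ⟨_, hzU m⟩).trans (hS.sprayExp_eq (hS.isTimeOneFlow_zeroSection m))

end LocalAddition

/-! ### Charts of the tangent bundle -/

section TangentChart

variable {B : Type*} [NormedAddCommGroup B] [NormedSpace ℝ B] {Y : Type*} [TopologicalSpace Y]
  [ChartedSpace B Y] [IsManifold 𝓘(ℝ, B) ∞ Y]

/-- The chart of the tangent bundle given by the preferred chart around `y`. -/
def tangentChart (y : Y) : PartialDiffeomorph (𝓘(ℝ, B).prod 𝓘(ℝ, B)) 𝓘(ℝ, B × B)
    (TotalSpace B (TangentSpace 𝓘(ℝ, B) : Y → Type _)) (B × B) ∞ where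
  toFun v := (chartAt B y v.proj, (trivializationAt B (TangentSpace 𝓘(ℝ, B)) y v).2)
  invFun z := (trivializationAt B (TangentSpace 𝓘(ℝ, B)) y).toOpenPartialHomeomorph.symm
    ((chartAt B y).symm z.1, z.2)
  source := π B (TangentSpace 𝓘(ℝ, B)) ⁻¹' (chartAt B y).source
  target := (chartAt B y).target ×ˢ univ
  map_source' v hv := ⟨(chartAt B y).map_source hv, mem_univ _⟩
  map_target' z hz := (trivializationAt B (TangentSpace 𝓘(ℝ, B)) y).map_target
    ⟨(chartAt B y).map_target hz.1, mem_univ _⟩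
  left_inv' v hv := by
    rw [(chartAt B y).left_inv hv]
    exact (trivializationAt B (TangentSpace 𝓘(ℝ, B)) y).left_inv hv
  right_inv' z hz := by
    have h := (trivializationAt B (TangentSpace 𝓘(ℝ, B)) y).right_inv
      (x := ((chartAt B y).symm z.1, z.2)) ⟨(chartAt B y).map_target hz.1, mem_univ _⟩
    have h1 := congrArg Prod.fst h
    have h2 := congrArg Prod.snd h
    exact Prod.ext ((congrArg (chartAt B y) h1).trans ((chartAt B y).right_inv hz.1)) h2
  open_source := (chartAt B y).open_source.preimage
    (FiberBundle.continuous_proj B (TangentSpace 𝓘(ℝ, B) : Y → Type _))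
  open_target := (chartAt B y).open_target.prod isOpen_univ
  contMDiffOn_toFun := by
    have h1 := (trivializationAt B (TangentSpace 𝓘(ℝ, B)) y).contMDiffOn
      (IB := 𝓘(ℝ, B)) (n := ∞)
    exact (contMDiffOn_chart.comp
      (contMDiff_proj (TangentSpace 𝓘(ℝ, B) : Y → Type _)).contMDiffOn fun _ h ↦ h).prodMk_space
        (contMDiff_snd.comp_contMDiffOn h1)
  contMDiffOn_invFun := by
    have h1 := (trivializationAt B (TangentSpace 𝓘(ℝ, B)) y).contMDiffOn_symm
      (IB := 𝓘(ℝ, B)) (n := ∞)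
    have h2 : ContMDiff 𝓘(ℝ, B × B) 𝓘(ℝ, B) ∞ (Prod.fst : B × B → B) := contDiff_fst.contMDiff
    have h3 : ContMDiff 𝓘(ℝ, B × B) 𝓘(ℝ, B) ∞ (Prod.snd : B × B → B) := contDiff_snd.contMDiff
    exact h1.comp ((contMDiffOn_chart_symm.comp h2.contMDiffOn fun _ h ↦ h.1).prodMk
      h3.contMDiffOn) fun z hz ↦ ⟨(chartAt B y).map_target hz.1, mem_univ _⟩

theorem tangentChart_apply (y : Y) {v : TotalSpace B (TangentSpace 𝓘(ℝ, B) : Y → Type _)}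
    (hv : v.proj ∈ (chartAt B y).source) :
    tangentChart y v =
      (chartAt B y v.proj, (mfderiv 𝓘(ℝ, B) 𝓘(ℝ, B) (chartAt B y) v.proj v.2 : B)) := by
  have h1 := TangentBundle.continuousLinearMapAt_trivializationAt (I := 𝓘(ℝ, B)) hv
  have h2 := DFunLike.congr_fun h1 v.2
  rw [Trivialization.continuousLinearMapAt_apply, Trivialization.coe_linearMapAt_of_mem _ hv] at h2
  exact Prod.ext rfl h2

end TangentChart

/-! ### Restriction of a spray to the fibres -/

section Fibre

variable {E E' F : Type*} [NormedAddCommGroup E] [NormedSpace ℝ E]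
  [NormedAddCommGroup E'] [NormedSpace ℝ E'] [NormedAddCommGroup F] [NormedSpace ℝ F]
  {M N : Type*} [TopologicalSpace M] [ChartedSpace E M] [IsManifold 𝓘(ℝ, E) ∞ M]
  [TopologicalSpace N] [ChartedSpace E' N] [IsManifold 𝓘(ℝ, E') ∞ N]
  {p : M → N} (hp : IsSubmersionOfComplement F 𝓘(ℝ, E) 𝓘(ℝ, E') ∞ p) {x : N}

theorem domChart_fibreIncl (y : Fibre hp x) {y' : Fibre hp x} (hy' : y' ∈ (chartAt F y).source) :
    (hp y.1).domChart (fibreIncl hp x y') =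
      (hp y.1).equiv.symm ((hp y.1).codChart x, chartAt F y y') := by
  rw [ContinuousLinearEquiv.eq_symm_apply]
  refine Prod.ext ?_ rfl
  have hy : fibreIncl hp x y' ∈ (hp y.1).domChart.source := hy'
  rw [submersion_chart_eq (hp y.1) hy]
  exact congrArg _ y'.2

theorem mfderiv_chartAt_fibre (y : Fibre hp x) {y' : Fibre hp x}
    (hy' : y' ∈ (chartAt F y).source) (w : TangentSpace 𝓘(ℝ, F) y') :
    (mfderiv 𝓘(ℝ, F) 𝓘(ℝ, F) (chartAt F y) y' w : F) =
      ((hp y.1).equiv (mfderiv 𝓘(ℝ, E) 𝓘(ℝ, E) (hp y.1).domChart (fibreIncl hp x y')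
        (mfderiv 𝓘(ℝ, F) 𝓘(ℝ, E) (fibreIncl hp x) y' w) : E)).2 := by
  have hy : fibreIncl hp x y' ∈ (hp y.1).domChart.source := hy'
  let L : E →L[ℝ] F := (ContinuousLinearMap.snd ℝ E' F).comp
    ((hp y.1).equiv : E →L[ℝ] E' × F)
  have h1 := L.hasMFDerivAt.comp y' ((mdifferentiableAt_domChart hp y.1 hy).hasMFDerivAt.comp y'
    ((contMDiff_fibreIncl hp x).mdifferentiable (by simp) y').hasMFDerivAt)
  exact DFunLike.congr_fun h1.mfderiv w

/-- The chart of the fibre is the `F`-component of the ambient chart, so its injective derivative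
factors through the derivative of the inclusion. -/
theorem mfderiv_fibreIncl_injective (y : Fibre hp x) :
    Injective (mfderiv 𝓘(ℝ, F) 𝓘(ℝ, E) (fibreIncl hp x) y) := by
  intro w w' h
  have hy := mem_chart_source F y
  apply (chartDiffeomorph y).mfderiv_injective (x := y) hy
  refine (mfderiv_chartAt_fibre hp y hy w).trans
    (Eq.trans ?_ (mfderiv_chartAt_fibre hp y hy w').symm)
  rw [h]

/-- The tangent map of the inclusion of a fibre in charts. -/
def fibreInclCoord (y : Fibre hp x) (z : F × F) : E × F :=
  ((hp y.1).equiv.symm ((hp y.1).codChart x, z.1), z.2)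

/-- The derivative of `fibreInclCoord`. -/
def fibreInclCoordDeriv (y : Fibre hp x) : F × F →L[ℝ] E × F :=
  (((hp y.1).equiv.symm : E' × F →L[ℝ] E).comp (ContinuousLinearMap.inr ℝ E' F)).prodMap
    (ContinuousLinearMap.id ℝ F)

theorem fibreInclCoordDeriv_apply (y : Fibre hp x) (z : F × F) :
    fibreInclCoordDeriv hp y z = ((hp y.1).equiv.symm (0, z.1), z.2) := rfl

theorem contDiff_fibreInclCoord (y : Fibre hp x) : ContDiff ℝ ∞ (fibreInclCoord hp y) := by
  unfold fibreInclCoord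
  fun_prop

theorem hasFDerivAt_fibreInclCoord (y : Fibre hp x) (z : F × F) :
    HasFDerivAt (fibreInclCoord hp y) (fibreInclCoordDeriv hp y) z := by
  have h1 : fibreInclCoord hp y = fun z ↦
      (((hp y.1).equiv.symm ((hp y.1).codChart x, 0), 0) : E × F) + fibreInclCoordDeriv hp y z := by
    funext z
    refine Prod.ext ?_ (by simp [fibreInclCoord, fibreInclCoordDeriv_apply])
    change (hp y.1).equiv.symm ((hp y.1).codChart x, z.1) =
      (hp y.1).equiv.symm ((hp y.1).codChart x, 0) + (hp y.1).equiv.symm (0, z.1)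
    rw [← map_add]
    simp
  rw [h1]
  exact (fibreInclCoordDeriv hp y).hasFDerivAt.const_add _

/-- A left inverse of `fibreInclCoordDeriv`. -/
def fibreProjCoord (y : Fibre hp x) : E × F →L[ℝ] F × F :=
  ((ContinuousLinearMap.snd ℝ E' F).comp ((hp y.1).equiv : E →L[ℝ] E' × F)).prodMap
    (ContinuousLinearMap.id ℝ F)

theorem fibreProjCoord_apply (y : Fibre hp x) (z : E × F) :
    fibreProjCoord hp y z = (((hp y.1).equiv z.1).2, z.2) := rfl

theorem fibreInclCoordDeriv_injective (y : Fibre hp x) :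
    Injective (fibreInclCoordDeriv hp y) := by
  refine LeftInverse.injective (g := fibreProjCoord hp y) fun z ↦ ?_
  simp [fibreInclCoordDeriv_apply, fibreProjCoord_apply]

theorem verticalChart_fibreTangentIncl (y : Fibre hp x)
    {v : TotalSpace F (TangentSpace 𝓘(ℝ, F) : Fibre hp x → Type _)}
    (hv : v ∈ (tangentChart y).source) :
    verticalChart hp y.1 (fibreTangentIncl hp x v) = fibreInclCoord hp y (tangentChart y v) := by
  rw [tangentChart_apply y hv]
  exact Prod.ext (domChart_fibreIncl hp y hv) (mfderiv_chartAt_fibre hp y hv v.2).symm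

theorem fibreTangentIncl_mem_source (y : Fibre hp x)
    {v : TotalSpace F (TangentSpace 𝓘(ℝ, F) : Fibre hp x → Type _)}
    (hv : v ∈ (tangentChart y).source) :
    fibreTangentIncl hp x v ∈ (verticalChart hp y.1).source := hv

theorem fibreInclCoord_mem_target (y : Fibre hp x) {z : F × F}
    (hz : z ∈ (tangentChart y).target) :
    fibreInclCoord hp y z ∈ (verticalChart hp y.1).target :=
  (mem_verticalChart_target hp).2 hz.1

/-- The target is the vertical bundle, not `TM`, so differentiability is read off from the affine
expression in the vertical chart. -/
theorem mdifferentiable_fibreTangentIncl :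
    MDifferentiable (𝓘(ℝ, F).prod 𝓘(ℝ, F)) (𝓘(ℝ, E).prod 𝓘(ℝ, F)) (fibreTangentIncl hp x) := by
  intro v
  let y := v.proj
  have hv : v ∈ (tangentChart y).source := mem_chart_source F y
  have h1 := ((verticalChart hp y.1).mdifferentiableAt_symm (fibreInclCoord_mem_target hp y
    ((tangentChart y).map_source hv))).comp (tangentChart y v)
    (hasFDerivAt_fibreInclCoord hp y _).differentiableAt.mdifferentiableAt |>.comp v
    ((tangentChart y).mdifferentiableAt_of_mem hv)
  refine h1.congr_of_eventuallyEq ?_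
  filter_upwards [(tangentChart y).open_source.mem_nhds hv] with w hw
  change _ = (verticalChart hp y.1).symm (fibreInclCoord hp y (tangentChart y w))
  rw [← verticalChart_fibreTangentIncl hp y hw]
  exact ((verticalChart hp y.1).left_inv (fibreTangentIncl_mem_source hp y hw)).symm

theorem mfderiv_verticalChart_fibreTangentIncl (y : Fibre hp x)
    {v : TotalSpace F (TangentSpace 𝓘(ℝ, F) : Fibre hp x → Type _)}
    (hv : v ∈ (tangentChart y).source) (ξ : TangentSpace (𝓘(ℝ, F).prod 𝓘(ℝ, F)) v) :
    (mfderiv (𝓘(ℝ, E).prod 𝓘(ℝ, F)) 𝓘(ℝ, E × F) (verticalChart hp y.1) (fibreTangentIncl hp x v)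
      (mfderiv (𝓘(ℝ, F).prod 𝓘(ℝ, F)) (𝓘(ℝ, E).prod 𝓘(ℝ, F)) (fibreTangentIncl hp x) v ξ) :
        E × F) =
      fibreInclCoordDeriv hp y
        (mfderiv (𝓘(ℝ, F).prod 𝓘(ℝ, F)) 𝓘(ℝ, F × F) (tangentChart y) v ξ : F × F) := by
  have h1 := ((verticalChart hp y.1).mdifferentiableAt_of_mem
    (fibreTangentIncl_mem_source hp y hv)).hasMFDerivAt.comp v
    (mdifferentiable_fibreTangentIncl hp v).hasMFDerivAt
  have h2 := (hasFDerivAt_fibreInclCoord hp y (tangentChart y v)).hasMFDerivAt.comp v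
    ((tangentChart y).mdifferentiableAt_of_mem hv).hasMFDerivAt
  have h3 : verticalChart hp y.1 ∘ fibreTangentIncl hp x =ᶠ[𝓝 v]
      fibreInclCoord hp y ∘ tangentChart y := by
    filter_upwards [(tangentChart y).open_source.mem_nhds hv] with w hw
    exact verticalChart_fibreTangentIncl hp y hw
  exact DFunLike.congr_fun (hasMFDerivAt_unique h1 (h2.congr_of_eventuallyEq h3)) ξ

theorem mfderiv_fibreTangentIncl_injective
    (v : TotalSpace F (TangentSpace 𝓘(ℝ, F) : Fibre hp x → Type _)) :
    Injective (mfderiv (𝓘(ℝ, F).prod 𝓘(ℝ, F)) (𝓘(ℝ, E).prod 𝓘(ℝ, F))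
      (fibreTangentIncl hp x) v) := by
  intro ξ ξ' h
  have hv : v ∈ (tangentChart v.proj).source := mem_chart_source F v.proj
  apply (tangentChart v.proj).mfderiv_injective hv
  apply fibreInclCoordDeriv_injective hp v.proj
  refine (mfderiv_verticalChart_fibreTangentIncl hp v.proj hv ξ).symm.trans
    (Eq.trans ?_ (mfderiv_verticalChart_fibreTangentIncl hp v.proj hv ξ'))
  rw [h]

variable {hp} (S : ∀ v : TotalSpace F (Vertical hp), TangentSpace (𝓘(ℝ, E).prod 𝓘(ℝ, F)) v)

/-- The restriction of a spray to a fibre, computed in the chart around `y`. -/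
def restrictSprayAt (y : Fibre hp x)
    (v : TotalSpace F (TangentSpace 𝓘(ℝ, F) : Fibre hp x → Type _)) :
    TangentSpace (𝓘(ℝ, F).prod 𝓘(ℝ, F)) v :=
  (mfderiv 𝓘(ℝ, F × F) (𝓘(ℝ, F).prod 𝓘(ℝ, F)) (tangentChart y).symm (tangentChart y v)
    (fibreProjCoord hp y ((verticalChart hp y.1).principalPart S
      (fibreInclCoord hp y (tangentChart y v)))) : F × F)

/-- The restriction of a spray to a fibre. -/
def restrictSpray (v : TotalSpace F (TangentSpace 𝓘(ℝ, F) : Fibre hp x → Type _)) :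
    TangentSpace (𝓘(ℝ, F).prod 𝓘(ℝ, F)) v :=
  restrictSprayAt S v.proj v

variable {S}

/-- `fibreProjCoord` discards only the `E'`-component of the principal part, and that component is
zero; including the result back therefore recovers `S`. -/
theorem IsSpray.mfderiv_restrictSprayAt (hS : IsSpray (verticalIncl hp) S) (y : Fibre hp x)
    {v : TotalSpace F (TangentSpace 𝓘(ℝ, F) : Fibre hp x → Type _)}
    (hv : v ∈ (tangentChart y).source) :
    mfderiv (𝓘(ℝ, F).prod 𝓘(ℝ, F)) (𝓘(ℝ, E).prod 𝓘(ℝ, F)) (fibreTangentIncl hp x) v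
      (restrictSprayAt S y v) = S (fibreTangentIncl hp x v) := by
  have hs := fibreTangentIncl_mem_source hp y hv
  apply (verticalChart hp y.1).mfderiv_injective hs
  refine (mfderiv_verticalChart_fibreTangentIncl hp y hv _).trans ?_
  have h1 : (mfderiv (𝓘(ℝ, F).prod 𝓘(ℝ, F)) 𝓘(ℝ, F × F) (tangentChart y) v
      (restrictSprayAt S y v) : F × F) = fibreProjCoord hp y
        ((verticalChart hp y.1).principalPart S (fibreInclCoord hp y (tangentChart y v))) :=
    (tangentChart y).mfderiv_mfderiv_symm_apply hv _
  rw [h1, ← (verticalChart hp y.1).principalPart_apply S hs,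
    verticalChart_fibreTangentIncl hp y hv]
  refine Prod.ext ?_ rfl
  have h2 := hS.fst_principalPart y.1 ((mem_verticalChart_target hp).1
    (fibreInclCoord_mem_target hp y ((tangentChart y).map_source hv)))
  rw [fibreInclCoordDeriv_apply, fibreProjCoord_apply, h2]
  simp

theorem IsSpray.mfderiv_restrictSpray (hS : IsSpray (verticalIncl hp) S)
    (v : TotalSpace F (TangentSpace 𝓘(ℝ, F) : Fibre hp x → Type _)) :
    mfderiv (𝓘(ℝ, F).prod 𝓘(ℝ, F)) (𝓘(ℝ, E).prod 𝓘(ℝ, F)) (fibreTangentIncl hp x) v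
      (restrictSpray S v) = S (fibreTangentIncl hp x v) :=
  hS.mfderiv_restrictSprayAt v.proj (mem_chart_source F v.proj)

theorem IsSpray.contMDiff_restrictSpray (hS : IsSpray (verticalIncl hp) S) :
    ContMDiff (𝓘(ℝ, F).prod 𝓘(ℝ, F)) (𝓘(ℝ, F).prod 𝓘(ℝ, F)).tangent ∞
      fun v ↦ (⟨v, restrictSpray S v⟩ : TangentBundle (𝓘(ℝ, F).prod 𝓘(ℝ, F))
        (TotalSpace F (TangentSpace 𝓘(ℝ, F) : Fibre hp x → Type _))) := by
  intro v
  let y := v.proj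
  have hv : v ∈ (tangentChart y).source := mem_chart_source F y
  have h1 : ContDiffOn ℝ ∞ (fun z ↦ fibreProjCoord hp y ((verticalChart hp y.1).principalPart S
      (fibreInclCoord hp y z))) (tangentChart y).target :=
    (fibreProjCoord hp y).contDiff.comp_contDiffOn
      (((verticalChart hp y.1).contDiffOn_principalPart hS.contMDiff).comp
        (contDiff_fibreInclCoord hp y).contDiffOn fun z hz ↦ fibreInclCoord_mem_target hp y hz)
  have h2 := ((tangentChart y).contMDiffOn_mfderiv_symm h1).contMDiffAt
    ((tangentChart y).open_source.mem_nhds hv)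
  refine h2.congr_of_eventuallyEq ?_
  filter_upwards [(tangentChart y).open_source.mem_nhds hv] with w hw
  -- `restrictSpray` uses a chart that changes with the point; the injective differential shows that
  -- the value does not depend on it, so one fixed chart serves near `v`.
  have h3 : restrictSpray S w = restrictSprayAt S y w := by
    apply mfderiv_fibreTangentIncl_injective hp w
    rw [hS.mfderiv_restrictSpray, hS.mfderiv_restrictSprayAt y hw]
  rw [h3]
  rfl

/-- Each axiom is checked after applying an injective differential, of the fibre inclusion or of its
tangent map, where it becomes the same axiom for `S`. -/
theorem IsSpray.isSpray_restrictSpray (hS : IsSpray (verticalIncl hp) S) :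
    IsSpray (fun y : Fibre hp x ↦ ContinuousLinearMap.id ℝ (TangentSpace 𝓘(ℝ, F) y))
      (restrictSpray S) where
  contMDiff := hS.contMDiff_restrictSpray
  lifts_anchor v := by
    apply mfderiv_fibreIncl_injective hp v.proj
    have h1 := ((contMDiff_fibreIncl hp x).mdifferentiable (by simp) v.proj).hasMFDerivAt.comp v
      ((contMDiff_proj (n := ∞) (IB := 𝓘(ℝ, F)) (F := F)
        (TangentSpace 𝓘(ℝ, F) : Fibre hp x → Type _)).mdifferentiable (by simp) v).hasMFDerivAt
    have h2 := ((contMDiff_proj (n := ∞) (IB := 𝓘(ℝ, E)) (F := F) (Vertical hp)).mdifferentiable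
      (by simp) (fibreTangentIncl hp x v)).hasMFDerivAt.comp v
        (mdifferentiable_fibreTangentIncl hp v).hasMFDerivAt
    have h3 := DFunLike.congr_fun (hasMFDerivAt_unique h1 h2) (restrictSpray S v)
    refine h3.trans ?_
    refine (congrArg (mfderiv (𝓘(ℝ, E).prod 𝓘(ℝ, F)) 𝓘(ℝ, E) (π F (Vertical hp))
      (fibreTangentIncl hp x v)) (hS.mfderiv_restrictSpray v)).trans ?_
    exact hS.lifts_anchor _
  homogeneous a v := by
    apply mfderiv_fibreTangentIncl_injective hp (bundleScale a v)
    have hcomm : fibreTangentIncl hp x ∘ bundleScale a =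
        bundleScale a ∘ fibreTangentIncl hp x := by
      funext w
      refine congrArg (TotalSpace.mk _) (Subtype.ext ?_)
      exact map_smul (mfderiv 𝓘(ℝ, F) 𝓘(ℝ, E) (fibreIncl hp x) w.1) a w.2
    have h1 := (mdifferentiable_fibreTangentIncl hp (bundleScale a v)).hasMFDerivAt.comp v
      (mdifferentiable_bundleScale a v).hasMFDerivAt
    have h2 := (mdifferentiable_bundleScale a (fibreTangentIncl hp x v)).hasMFDerivAt.comp v
      (mdifferentiable_fibreTangentIncl hp v).hasMFDerivAt
    rw [hcomm] at h1
    have h3 := DFunLike.congr_fun (hasMFDerivAt_unique h1 h2) (a • restrictSpray S v)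
    refine (hS.mfderiv_restrictSpray _).trans (Eq.trans ?_ h3.symm)
    have h4 : S (bundleScale a (fibreTangentIncl hp x v)) = _ :=
      hS.homogeneous a (fibreTangentIncl hp x v)
    -- The two base points are equal but not syntactically so; the values of `S` are compared in the
    -- model space `E × F`.
    have h5 : S (fibreTangentIncl hp x (bundleScale a v)) =
        (S (bundleScale a (fibreTangentIncl hp x v)) : E × F) :=
      congrArg (fun w ↦ (S w : E × F)) (congrFun hcomm v)
    refine h5.trans (h4.trans ?_)
    rw [← hS.mfderiv_restrictSpray v, ← map_smul]
    rfl

/-- A spray on the vertical bundle restricts to a unique spray on every fibre. -/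
theorem IsSpray.existsUnique_restrict (hS : IsSpray (verticalIncl hp) S) (x : N) :
    ∃! Sx : ∀ v : TotalSpace F (TangentSpace 𝓘(ℝ, F) : Fibre hp x → Type _),
        TangentSpace (𝓘(ℝ, F).prod 𝓘(ℝ, F)) v,
      IsSpray (fun y ↦ ContinuousLinearMap.id ℝ (TangentSpace 𝓘(ℝ, F) y)) Sx ∧
      ∀ v, mfderiv (𝓘(ℝ, F).prod 𝓘(ℝ, F)) (𝓘(ℝ, E).prod 𝓘(ℝ, F))
        (fibreTangentIncl hp x) v (Sx v) = S (fibreTangentIncl hp x v) := by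
  refine ⟨restrictSpray S, ⟨hS.isSpray_restrictSpray, hS.mfderiv_restrictSpray⟩, ?_⟩
  -- Uniqueness needs only relatedness to `S`, not the spray axioms.
  rintro Sx ⟨-, h⟩
  funext v
  apply mfderiv_fibreTangentIncl_injective hp v
  rw [h, hS.mfderiv_restrictSpray]

end Fibre

end Spray

end

/-! ### The main theorem -/

theorem mainTheorem5 {E E' F : Type*}
    [NormedAddCommGroup E] [NormedSpace ℝ E] [CompleteSpace E]
    [NormedAddCommGroup E'] [NormedSpace ℝ E'] [CompleteSpace E']
    [NormedAddCommGroup F] [NormedSpace ℝ F]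
    {M N : Type*}
    [TopologicalSpace M] [T2Space M] [ChartedSpace E M] [IsManifold 𝓘(ℝ, E) ∞ M]
    [TopologicalSpace N] [T2Space N] [ChartedSpace E' N] [IsManifold 𝓘(ℝ, E') ∞ N]
    (p : M → N) (hp : IsSubmersionOfComplement F 𝓘(ℝ, E) 𝓘(ℝ, E') ∞ p)
    (hsurj : Function.Surjective p) :
    (∀ S : ∀ v : TotalSpace F (Spray.Vertical hp), TangentSpace (𝓘(ℝ, E).prod 𝓘(ℝ, F)) v,
      Spray.IsSpray (Spray.verticalIncl hp) S →
      ∀ x : N, ∃! Sx : ∀ v : TotalSpace F (TangentSpace 𝓘(ℝ, F) : Spray.Fibre hp x → Type _),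
          TangentSpace (𝓘(ℝ, F).prod 𝓘(ℝ, F)) v,
        Spray.IsSpray (fun y ↦ ContinuousLinearMap.id ℝ (TangentSpace 𝓘(ℝ, F) y)) Sx ∧
        ∀ v, mfderiv (𝓘(ℝ, F).prod 𝓘(ℝ, F)) (𝓘(ℝ, E).prod 𝓘(ℝ, F))
          (Spray.fibreTangentIncl hp x) v (Sx v) = S (Spray.fibreTangentIncl hp x v)) ∧
    (Spray.SmoothlyParacompact E M →
      (∃ S : ∀ v : TotalSpace F (Spray.Vertical hp), TangentSpace (𝓘(ℝ, E).prod 𝓘(ℝ, F)) v,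
        Spray.IsSpray (Spray.verticalIncl hp) S) ∧
      ∀ S : ∀ v : TotalSpace F (Spray.Vertical hp), TangentSpace (𝓘(ℝ, E).prod 𝓘(ℝ, F)) v,
        Spray.IsSpray (Spray.verticalIncl hp) S →
        ∃ (U : TopologicalSpace.Opens (TotalSpace F (Spray.Vertical hp)))
          (Ψ : U → Spray.FibreProduct hp),
          Spray.IsLocalAddition hp U Ψ ∧
          ∀ u : U, (u : TotalSpace F (Spray.Vertical hp)) ∈ Spray.expDomain S ∧
            (Ψ u).snd = Spray.sprayExp S u) := by
  exact ⟨fun S hS x ↦ hS.existsUnique_restrict x, fun hM ↦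
    ⟨Spray.exists_isSpray hp hM, fun S hS ↦ hS.exists_isLocalAddition hM⟩⟩
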